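/- Conventions. For a group $G$, an $EG$ is a contractible CW complex with a proper, cocompact, cellular $G$-action, equipped with a proper $G$-invariant metric. Let $K$ be a finite simplicial complex with vertex set $K^{(0)}$. Put $\operatorname{Cone}_\infty(K)=K\times[0,\infty)/K\times 0$. The ordered simplicial configuration space $\widetilde{\mathcal C}(K)$ consists of the cells $(\sigma,\tau)$ with $\sigma,\tau$ disjoint simplices of $K$; the involution $\iota$ exchanges the factors, acting on oriented cellular chains by $\iota(\sigma,\tau)=(-1)^{\dim\sigma\dim\tau}(\tau,\sigma)$, and $\mathcal C(K)=\widetilde{\mathcal C}(K)/\iota$. The mod 2 van Kampen class $\mathrm{vk}^n_{\mathbb Z/2}(K)\in H^n(\mathcal C(K);\mathbb Z/2)$ is the pullback of the nonzero class of $H^n(\mathbb{RP}^\infty;\mathbb Z/2)$ under the map classifying this double cover. For $n\ge 0$, let $\mathbb Z^{\pm}$ be $\mathbb Z$ with the generator of $\mathbb Z/2$ acting by $(-1)^{n+1}$. An *evaluation $n$-cycle* of $K$ is a cellular $n$-cycle $\Phi$ of $\mathcal C(K)$ with coefficients in $\mathbb Z^{\pm}$ (i.e. in the quotient of the chains of $\widetilde{\mathcal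 C}(K)$ by $c\sim(-1)^{n+1}\iota c$) such that $\langle \mathrm{vk}^n_{\mathbb Z/2}(K),\Phi \bmod 2\rangle\neq 0$ and, for each $n$-simplex $\sigma$, $\sum_{v} a_{(\sigma,v)}=0$, where $v$ runs over the vertices not in $\sigma$ and $a_{(\sigma,v)}$ is the coefficient of $\Phi$ with respect to the generator $[(\sigma,v)]$. If a finite group $H$ acts simplicially on $K$, then $K$ is an *equivariant $(n+1)$-obstructor* if it has an evaluation $n$-cycle $\Phi$ and there is a nonempty subset $A$ of the subgroup $S(H)$ generated by the squares of elements of $H$ with $\sum_{h\in A}h_*\Phi=0$ as chains ($H$ acting trivially on coefficients). A proper map $f:\operatorname{Cone}_\infty(K)\to EG$ is *expanding* if for any disjoint simplices $\sigma,\tau$ of $K$ the distance between $f(\sigma\times[t,\infty))$ and $f(\tau\times[t,\infty))$ tends to infinity as $t\to\infty$. It is *$H$-preserving* if for every $h\in H$ there are $g_h\in G$, $R>0$ and a proper homotopy $(j^s)_{s\in[0,1]}$ from $f\circ h$ to $g_h\circ f$ with $j^s(\operatorname{Cone}_\infty\sigma)\subset N_R(f\circ h(\operatorname{Cone}_\infty\sigma))$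 for all simplices $\sigma$ and all $s$ (the $H$-action on $\operatorname{Cone}_\infty(K)$ is trivial on $[0,\infty)$). The $\mathbb Z$-valued obstructor dimension $\operatorname{obdim}_{\mathbb Z}(G)$ is the supremum of the numbers $n+2$, $n\ge0$, for which there are an $EG$, a finite complex $K$ with an evaluation $n$-cycle, and a proper expanding map $\operatorname{Cone}_\infty(K)\to EG$. The equivariant obstructor dimension $\operatorname{eqobdim}(G)$ is the supremum of the numbers $n+3$, $n\ge0$, for which there are an $EG$, a finite group $H$, a finite $H$-complex $K$ which is an equivariant $(n+1)$-obstructor, and an $H$-preserving proper expanding map $\operatorname{Cone}_\infty(K)\to EG$. Both take values in $\{-\infty\}\cup\mathbb N\cup\{\infty\}$, the supremum of the empty set is $-\infty$, and $-\infty+x=-\infty$ for every $x$. **Lemma.** For all groups $G_1$ and $G_2$, $$\operatorname{eqobdim}(G_1\times G_2)\ \ge\ \operatorname{eqobdim}(G_1)+\operatorname{obdim}_{\mathbb Z}(G_2).$$ -/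

import Mathlib

namespace EqObdim

/-! ### The simplicial configuration space

`K` is a finite simplicial complex with vertex set `V`; a simplex is the finite set of its vertices,
oriented by the order of `V`. -/

section Config

/-- `(σ, τ)` is a cell of the ordered simplicial configuration space of `K`: a pair of disjoint
simplices.  Its dimension is `dim σ + dim τ = σ.card + τ.card - 2`. -/
def IsConfigCell {V : Type} (K : AbstractSimplicialComplex V) (σ τ : Finset V) : Prop :=
  σ ∈ K.faces ∧ τ ∈ K.faces ∧ Disjoint σ τ

/-- Cellular `n`-chains of the unordered configuration space `C(K)` with coefficients in the module
`ℤ` on which the generator of `ℤ/2` acts by `(-1)^(n+1)`, that is, elements of the quotient of the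
ordered cellular `n`-chains by `c ∼ (-1)^(n+1) ι c`, where
`ι (σ, τ) = (-1)^(dim σ * dim τ) (τ, σ)`.
Since `ι` permutes the cells freely up to sign, the quotient has one basis element for each unordered
cell, and a chain is recorded by its coefficients: `a σ τ` is the coefficient of the
cell `{σ, τ}` with respect to the generator `[(σ, τ)]`.  The relation
`[(σ, τ)] = (-1)^(n+1) (-1)^(dim σ * dim τ) [(τ, σ)]` between the two possible generators is `symm`. -/
structure IsTwistedChain {V : Type} (K : AbstractSimplicialComplex V) (n : ℕ)
    (a : Finset V → Finset V → ℤ) : Prop where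
  support : ∀ σ τ, a σ τ ≠ 0 → IsConfigCell K σ τ ∧ σ.card + τ.card = n + 2
  symm : ∀ σ τ, a τ σ = (-1) ^ (n + 1) * (-1) ^ ((σ.card - 1) * (τ.card - 1)) * a σ τ

/-- The incidence sign of the facet `ρ` in the simplex `ρ ∪ {v}`: minus one to the number of the
position of `v` in `ρ ∪ {v}`, counted from `0`. -/
def incidence {V : Type} [LinearOrder V] (v : V) (ρ : Finset V) : ℤ :=
  (-1) ^ (ρ.filter (· < v)).card

/-- The coefficient at `(ρ, τ)` of the boundary of a chain, for the boundary
`∂ (σ, τ) = (∂ σ, τ) + (-1)^(dim σ) (σ, ∂ τ)`. -/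
def boundary {V : Type} [Fintype V] [LinearOrder V] (a : Finset V → Finset V → ℤ)
    (ρ τ : Finset V) : ℤ :=
  (∑ v ∈ Finset.univ \ ρ, incidence v ρ * a (insert v ρ) τ) +
    (-1) ^ (ρ.card - 1) * ∑ v ∈ Finset.univ \ τ, incidence v τ * a ρ (insert v τ)

/-- The sign of the map `σ → h σ` between oriented simplices. -/
def orientSign {V H : Type} [LinearOrder V] [Group H] [MulAction H V] (h : H) (σ : Finset V) : ℤ :=
  (-1) ^ ((σ ×ˢ σ).filter fun p => p.1 < p.2 ∧ h • p.2 < h • p.1).card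

/-- The action `h_*` on chains, induced by
`h (σ, τ) = orientSign h σ * orientSign h τ * (h σ, h τ)`; `H` acts trivially on coefficients. -/
def pushforward {V H : Type} [LinearOrder V] [Group H] [MulAction H V] (h : H)
    (a : Finset V → Finset V → ℤ) (σ τ : Finset V) : ℤ :=
  orientSign h (σ.image (h⁻¹ • ·)) * orientSign h (τ.image (h⁻¹ • ·)) *
    a (σ.image (h⁻¹ • ·)) (τ.image (h⁻¹ • ·))

/-! ### The `ℤ/2`-valued van Kampen obstruction

`S^∞` has the `ℤ/2`-equivariant cell structure with two cells `e_i`, `ι e_i` in each dimension and,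
modulo 2, `∂ e_i = ∂ ι e_i = e_{i-1} + ι e_{i-1}`.  An `i`-chain `x e_i + y ι e_i` is recorded as the
pair `(x, y)`.  The class `w₁^n` of `ℝP^∞` is the cocycle with the value `1` on the `n`-cell. -/

/-- `φ` is an equivariant, augmentation preserving cellular chain map, modulo 2, from the ordered
configuration space of `K` to `S^∞`, i.e. one which represents the map classifying the double
cover of `C(K)`. -/
structure IsClassifyingMap {V : Type} [DecidableEq V] (K : AbstractSimplicialComplex V)
    (φ : Finset V → Finset V → ZMod 2 × ZMod 2) : Prop where
  equivariant : ∀ σ τ, IsConfigCell K σ τ → φ τ σ = (φ σ τ).swap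
  augmentation : ∀ v w : V, IsConfigCell K {v} {w} → (φ {v} {w}).1 + (φ {v} {w}).2 = 1
  chain_map : ∀ σ τ, IsConfigCell K σ τ → 3 ≤ σ.card + τ.card →
    (∑ v ∈ σ.filter (fun v => (σ.erase v).Nonempty), φ (σ.erase v) τ) +
      (∑ v ∈ τ.filter (fun v => (τ.erase v).Nonempty), φ σ (τ.erase v)) =
    ((φ σ τ).1 + (φ σ τ).2, (φ σ τ).1 + (φ σ τ).2)

/-- The value on the chain `a`, reduced modulo 2, of the pullback of `w₁^n` under `φ`. The sum runs
over the cells of the unordered configuration space: the cell `{σ, τ}` is represented by the pair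
in which `σ` contains the smallest vertex of `σ ∪ τ`. -/
def vkPairing {V : Type} [Fintype V] [LinearOrder V] (φ : Finset V → Finset V → ZMod 2 × ZMod 2)
    (a : Finset V → Finset V → ℤ) : ZMod 2 :=
  ∑ σ : Finset V, ∑ τ : Finset V,
    if σ.min < τ.min then (a σ τ : ZMod 2) * ((φ σ τ).1 + (φ σ τ).2) else 0

/-- Evaluation `n`-cycles of `K`.  (The value in `vk_ne_zero` does not depend on `φ`: two
equivariant chain maps to `S^∞` are equivariantly chain homotopic.) -/
structure IsEvaluationCycle {V : Type} [Fintype V] [LinearOrder V] (K : AbstractSimplicialComplex V)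
    (n : ℕ) (a : Finset V → Finset V → ℤ) : Prop where
  chain : IsTwistedChain K n a
  cycle : ∀ ρ τ, IsConfigCell K ρ τ → boundary a ρ τ = 0
  vk_ne_zero : ∃ φ, IsClassifyingMap K φ ∧ vkPairing φ a ≠ 0
  balanced : ∀ σ : Finset V, σ.card = n + 1 → ∑ v : V, a σ {v} = 0

/-- The action of `H` on the vertices makes `K` an `H`-complex. -/
def IsInvariant (H : Type) {V : Type} [DecidableEq V] [Group H] [MulAction H V]
    (K : AbstractSimplicialComplex V) : Prop :=
  ∀ (h : H), ∀ σ ∈ K.faces, σ.image (h • ·) ∈ K.faces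

/-- The subgroup `S(H)` generated by the squares. -/
def squareSubgroup (H : Type) [Group H] : Subgroup H :=
  Subgroup.closure (Set.range fun h : H => h ^ 2)

/-- The `H`-complex `K` is an equivariant `(n+1)`-obstructor. -/
def IsEquivariantObstructor (H : Type) {V : Type} [Fintype V] [LinearOrder V] [Group H]
    [MulAction H V] (K : AbstractSimplicialComplex V) (n : ℕ) : Prop :=
  ∃ a, IsEvaluationCycle K n a ∧ ∃ A : Finset H, A.Nonempty ∧ (∀ h ∈ A, h ∈ squareSubgroup H) ∧
    ∀ σ τ, ∑ h ∈ A, pushforward h a σ τ = 0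

end Config

/-! ### The infinite cone -/

section Cone

/-- `Cone_∞(K) = K × [0,∞) / K × 0`.  The class of `(x, t)`, where `x ∈ K` has barycentric
coordinates `x v`, is the vector `t x`; so `t` is the sum of the coordinates. -/
def ConeInfty {V : Type} (K : AbstractSimplicialComplex V) : Set (V → ℝ) :=
  {w | (∀ v, 0 ≤ w v) ∧ ∃ σ ∈ K.faces, ∀ v, v ∉ σ → w v = 0}

/-- `σ × [t,∞)`, as a subset of `Cone_∞(K)`. -/
def coneFrom {V : Type} [Fintype V] (K : AbstractSimplicialComplex V) (σ : Finset V) (t : ℝ) :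
    Set (ConeInfty K) :=
  {w | (∀ v, v ∉ σ → w.1 v = 0) ∧ t ≤ ∑ v, w.1 v}

/-- `Cone_∞(σ)`, as a subset of `Cone_∞(K)`. -/
def coneOver {V : Type} (K : AbstractSimplicialComplex V) (σ : Finset V) : Set (ConeInfty K) :=
  {w | ∀ v, v ∉ σ → w.1 v = 0}

/-- The action of `H` on `Cone_∞(K)`, trivial on the coordinate `t`. -/
def coneAct {H V : Type} [DecidableEq V] [Group H] [MulAction H V] {K : AbstractSimplicialComplex V}
    (hK : IsInvariant H K) (h : H) (w : ConeInfty K) : ConeInfty K :=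
  ⟨fun v => w.1 (h⁻¹ • v), fun v => w.2.1 _, by
    obtain ⟨σ, hσ, hw⟩ := w.2.2
    refine ⟨_, hK h σ hσ, fun v hv => hw _ fun hm => hv ?_⟩
    exact Finset.mem_image.2 ⟨_, hm, smul_inv_smul h v⟩⟩

/-- `f` is expanding: for disjoint simplices `σ`, `τ`, the distance between the images of
`σ × [t,∞)` and `τ × [t,∞)` goes to infinity with `t`. -/
def IsExpanding {V X : Type} [Fintype V] [MetricSpace X] {K : AbstractSimplicialComplex V}
    (f : ConeInfty K → X) : Prop :=
  ∀ σ ∈ K.faces, ∀ τ ∈ K.faces, Disjoint σ τ → ∀ R : ℝ, ∃ T : ℝ, ∀ t ≥ T,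
    ∀ x ∈ coneFrom K σ t, ∀ y ∈ coneFrom K τ t, R ≤ dist (f x) (f y)

/-- `f : Cone_∞(K) → X` is `H`-preserving, for a `G`-space `X`. -/
def IsPreserving {G : Type*} {H V X : Type} [Group G] [MetricSpace X] [MulAction G X]
    [DecidableEq V] [Group H] [MulAction H V] {K : AbstractSimplicialComplex V}
    (hK : IsInvariant H K) (f : ConeInfty K → X) : Prop :=
  ∀ h : H, ∃ (g : G) (R : ℝ), 0 < R ∧ ∃ j : unitInterval × ConeInfty K → X, IsProperMap j ∧
    (∀ w, j (0, w) = f (coneAct hK h w)) ∧ (∀ w, j (1, w) = g • f w) ∧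
    ∀ σ ∈ K.faces, ∀ s, ∀ w ∈ coneOver K σ,
      j (s, w) ∈ Metric.thickening R ((fun u => f (coneAct hK h u)) '' coneOver K σ)

end Cone

/-! ### Obstructor dimensions -/

section Dimension

/-- `X` is an `EG`: a contractible CW complex with a proper `G`-invariant metric and a proper
cocompact cellular action of `G`. -/
structure IsEG (G : Type*) (X : Type) [Group G] [MetricSpace X] [MulAction G X] : Prop where
  contractible : ContractibleSpace X
  properSpace : ProperSpace X
  isometric : IsIsometricSMul G X
  properlyDiscontinuous : ProperlyDiscontinuousSMul G X
  cocompact : ∃ C : Set X, IsCompact C ∧ ∀ x : X, ∃ g : G, g • x ∈ C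
  cellular : ∃ _ : Topology.CWComplex (Set.univ : Set X),
    ∀ (g : G) (n : ℕ) (e : Topology.RelCWComplex.cell (Set.univ : Set X) n),
      ∃ e' : Topology.RelCWComplex.cell (Set.univ : Set X) n,
        (fun x : X => g • x) '' Topology.RelCWComplex.openCell n e =
          Topology.RelCWComplex.openCell n e'

/-- There is a proper expanding map `Cone_∞(K) → EG`, where `K` has an evaluation `n`-cycle. -/
def HasEvaluationCone (G : Type*) [Group G] (n : ℕ) : Prop :=
  ∃ (X : Type) (_ : MetricSpace X) (_ : MulAction G X) (V : Type) (_ : Fintype V)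
    (_ : LinearOrder V) (K : AbstractSimplicialComplex V) (f : ConeInfty K → X),
    IsEG G X ∧ (∃ a, IsEvaluationCycle K n a) ∧ IsProperMap f ∧ IsExpanding f

/-- There is an `H`-preserving proper expanding map `Cone_∞(K) → EG`, where `H` is a finite group and
`K` is an `H`-equivariant `(n+1)`-obstructor. -/
def HasEquivariantCone (G : Type*) [Group G] (n : ℕ) : Prop :=
  ∃ (X : Type) (_ : MetricSpace X) (_ : MulAction G X) (V : Type) (_ : Fintype V)
    (_ : LinearOrder V) (K : AbstractSimplicialComplex V) (H : Type) (_ : Group H) (_ : Finite H)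
    (_ : MulAction H V) (hK : IsInvariant H K) (f : ConeInfty K → X),
    IsEG G X ∧ IsEquivariantObstructor H K n ∧ IsProperMap f ∧ IsExpanding f ∧
      IsPreserving (G := G) hK f

/-- The `ℤ`-valued obstructor dimension: the maximal `n + 2` as in `HasEvaluationCone`
(`⊥ = -∞` if there is no such `n`, and `⊤ = ∞` if there are arbitrarily large ones). -/
noncomputable def obdimZ (G : Type*) [Group G] : WithBot ℕ∞ :=
  sSup {d | ∃ n : ℕ, HasEvaluationCone G n ∧ d = ((n + 2 : ℕ) : WithBot ℕ∞)}

/-- The equivariant obstructor dimension: the maximal `n + 3` as in `HasEquivariantCone`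
(`⊥ = -∞` if there is no such `n`, and `⊤ = ∞` if there are arbitrarily large ones). -/
noncomputable def eqobdim (G : Type*) [Group G] : WithBot ℕ∞ :=
  sSup {d | ∃ n : ℕ, HasEquivariantCone G n ∧ d = ((n + 3 : ℕ) : WithBot ℕ∞)}

end Dimension

end EqObdim

set_option linter.unusedSectionVars false

/-! Let `K`, `L` be complexes with cone maps `f : Cone K → X` and `g : Cone L → Y` and evaluation
cycles `a`, `b` of dimensions `m`, `n`, where `K` is an equivariant obstructor for `H`. The product
is handled by the join `K * L`, with `H` acting trivially on `L`, and by `f × g` on `Cone (K * L) =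
Cone K × Cone L`. The join of the cycles has dimension `m + n + 2`, and `(m + n + 2) + 3 = (m + 3) +
(n + 2)`.

The algebra takes place on deleted joins, whose cells are pairs of disjoint, possibly empty
simplices: the deleted join of `K * L` is the join of the deleted joins of `K` and `L`. The balance
condition says exactly that an evaluation cycle remains a cycle when empty simplices are admitted,
so the Leibniz rule makes `a * b` a cycle (`IsEvaluationCycle.boundary_join`). Since `h_*(a * b) =
(h_* a) * b`, the set `A` that kills `a` also kills `a * b`. Equivariant maps to `S^∞` extend to the
deleted joins and can be joined there; the van Kampen pairing becomes multiplicative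
(`vkPairing_join`), hence is nonzero on `a * b`.

In the geometry, a point far out in a product of cones is far out in one factor, and properness
covers the case in which the other point is near the apex in that factor; so `f × g` is expanding. A
homotopy for `f` times the identity of `Cone L` shows that it is `H`-preserving. Since `X × Y` is
metrizable, compact sets determine its topology and the product cells form a CW structure, so `X ×
Y` is an `E(G₁ × G₂)` (`IsEG.prod`). -/

namespace EqObdim

/-! ### The join of two simplicial complexes -/

/-- The vertex set of the join. -/
inductive JoinVertex (V W : Type) : Type
  | left (v : V) : JoinVertex V W
  | right (w : W) : JoinVertex V W

namespace JoinVertex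

variable {V W : Type}

/-- The vertices of a join as a disjoint union. -/
def equivSum (V W : Type) : JoinVertex V W ≃ V ⊕ W where
  toFun x := match x with
    | left v => Sum.inl v
    | right w => Sum.inr w
  invFun x := match x with
    | Sum.inl v => left v
    | Sum.inr w => right w
  left_inv x := by cases x <;> rfl
  right_inv x := by cases x <;> rfl

instance [Fintype V] [Fintype W] : Fintype (JoinVertex V W) :=
  Fintype.ofEquiv (V ⊕ W) (equivSum V W).symm

/-- The vertices of the first complex precede those of the second. -/
instance [LinearOrder V] [LinearOrder W] : LinearOrder (JoinVertex V W) :=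
  LinearOrder.lift' (fun x => toLex (equivSum V W x))
    (toLex.injective.comp (equivSum V W).injective)

section Order

variable [LinearOrder V] [LinearOrder W]

lemma lt_iff (x y : JoinVertex V W) :
    x < y ↔ toLex (equivSum V W x) < toLex (equivSum V W y) := Iff.rfl

@[simp] lemma left_lt_left {v v' : V} : (left v : JoinVertex V W) < left v' ↔ v < v' := by
  rw [lt_iff]; exact Sum.Lex.inl_lt_inl_iff

@[simp] lemma right_lt_right {w w' : W} : (right w : JoinVertex V W) < right w' ↔ w < w' := by
  rw [lt_iff]; exact Sum.Lex.inr_lt_inr_iff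

@[simp] lemma left_lt_right {v : V} {w : W} : (left v : JoinVertex V W) < right w := by
  rw [lt_iff]; exact Sum.Lex.inl_lt_inr _ _

@[simp] lemma not_right_lt_left {v : V} {w : W} : ¬ (right w : JoinVertex V W) < left v :=
  left_lt_right.asymm

end Order

/-- A group acting on `V` acts on the vertices of the join, trivially on `W`. -/
instance {H : Type} [Group H] [MulAction H V] : MulAction H (JoinVertex V W) where
  smul h x := match x with
    | left v => left (h • v)
    | right w => right w
  one_smul x := by
    cases x with
    | left v => exact congrArg left (one_smul H v)
    | right w => rfl
  mul_smul g h x := by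
    cases x with
    | left v => exact congrArg left (mul_smul g h v)
    | right w => rfl

@[simp] lemma smul_left {H : Type} [Group H] [MulAction H V] (h : H) (v : V) :
    h • (left v : JoinVertex V W) = left (h • v) := rfl

@[simp] lemma smul_right {H : Type} [Group H] [MulAction H V] (h : H) (w : W) :
    h • (right w : JoinVertex V W) = right w := rfl

/-- A sum over the vertices of a join. -/
lemma sum_univ [Fintype V] [Fintype W] {M : Type*} [AddCommMonoid M] (F : JoinVertex V W → M) :
    ∑ x, F x = ∑ v, F (left v) + ∑ w, F (right w) := by
  rw [← (equivSum V W).symm.sum_comp, Fintype.sum_sum_type]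
  rfl

end JoinVertex

open JoinVertex

/-! ### Sets of vertices of a join as pairs of sets of vertices. -/

section Parts

variable {V W : Type} [Fintype V] [Fintype W] [LinearOrder V] [LinearOrder W]

/-- The part of a set of vertices which lies in the first complex. -/
def leftPart (σ : Finset (JoinVertex V W)) : Finset V := Finset.univ.filter (left · ∈ σ)

/-- The part of a set of vertices which lies in the second complex. -/
def rightPart (σ : Finset (JoinVertex V W)) : Finset W := Finset.univ.filter (right · ∈ σ)

@[simp] lemma mem_leftPart {σ : Finset (JoinVertex V W)} {v : V} :
    v ∈ leftPart σ ↔ left v ∈ σ := by simp [leftPart]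

@[simp] lemma mem_rightPart {σ : Finset (JoinVertex V W)} {w : W} :
    w ∈ rightPart σ ↔ right w ∈ σ := by simp [rightPart]

/-- Sets of vertices of a join are pairs of sets of vertices. -/
def partsEquiv (V W : Type) [Fintype V] [Fintype W] [LinearOrder V] [LinearOrder W] :
    Finset (JoinVertex V W) ≃ Finset V × Finset W where
  toFun σ := (leftPart σ, rightPart σ)
  invFun p := p.1.image left ∪ p.2.image right
  left_inv σ := by ext x; cases x <;> simp
  right_inv p := by ext <;> simp

@[simp] lemma leftPart_partsEquiv_symm (p : Finset V × Finset W) :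
    leftPart ((partsEquiv V W).symm p) = p.1 := congrArg Prod.fst ((partsEquiv V W).right_inv p)

@[simp] lemma rightPart_partsEquiv_symm (p : Finset V × Finset W) :
    rightPart ((partsEquiv V W).symm p) = p.2 := congrArg Prod.snd ((partsEquiv V W).right_inv p)

lemma sum_parts {M : Type*} [AddCommMonoid M] (σ : Finset (JoinVertex V W))
    (F : JoinVertex V W → M) :
    ∑ x ∈ σ, F x = ∑ v ∈ leftPart σ, F (left v) + ∑ w ∈ rightPart σ, F (right w) := by
  rw [leftPart, rightPart, Finset.sum_filter, Finset.sum_filter,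
    ← JoinVertex.sum_univ (fun x => if x ∈ σ then F x else 0)]
  simp

lemma sum_finset_join {M : Type*} [AddCommMonoid M] (F : Finset (JoinVertex V W) → M) :
    ∑ σ, F σ = ∑ ρ : Finset V, ∑ κ : Finset W, F ((partsEquiv V W).symm (ρ, κ)) := by
  rw [← (partsEquiv V W).symm.sum_comp, Fintype.sum_prod_type]

lemma card_parts (σ : Finset (JoinVertex V W)) :
    σ.card = (leftPart σ).card + (rightPart σ).card := by
  simpa using sum_parts σ (fun _ => (1 : ℕ))

lemma eq_empty_iff_parts (σ : Finset (JoinVertex V W)) :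
    σ = ∅ ↔ leftPart σ = ∅ ∧ rightPart σ = ∅ := by
  simp only [← Finset.card_eq_zero, card_parts σ]; omega

lemma nonempty_of_leftPart {σ : Finset (JoinVertex V W)} (h : (leftPart σ).Nonempty) :
    σ.Nonempty := by
  obtain ⟨v, hv⟩ := h
  exact ⟨_, mem_leftPart.1 hv⟩

lemma disjoint_parts {σ τ : Finset (JoinVertex V W)} (h : Disjoint σ τ) :
    Disjoint (leftPart σ) (leftPart τ) ∧ Disjoint (rightPart σ) (rightPart τ) := by
  simp only [Finset.disjoint_left, mem_leftPart, mem_rightPart] at h ⊢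
  exact ⟨fun v => @h _, fun w => @h _⟩

lemma disjoint_of_parts {σ τ : Finset (JoinVertex V W)}
    (h : Disjoint (leftPart σ) (leftPart τ)) (h' : Disjoint (rightPart σ) (rightPart τ)) :
    Disjoint σ τ := by
  simp only [Finset.disjoint_left, mem_leftPart, mem_rightPart] at h h' ⊢
  intro x
  cases x with
  | left v => exact @h v
  | right w => exact @h' w

@[simp] lemma leftPart_empty : leftPart (∅ : Finset (JoinVertex V W)) = ∅ := by
  ext; simp

@[simp] lemma rightPart_empty : rightPart (∅ : Finset (JoinVertex V W)) = ∅ := by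
  ext; simp

@[simp] lemma leftPart_univ_sdiff (σ : Finset (JoinVertex V W)) :
    leftPart (Finset.univ \ σ) = Finset.univ \ leftPart σ := by
  ext; simp

@[simp] lemma rightPart_univ_sdiff (σ : Finset (JoinVertex V W)) :
    rightPart (Finset.univ \ σ) = Finset.univ \ rightPart σ := by
  ext; simp

@[simp] lemma leftPart_insert_left (σ : Finset (JoinVertex V W)) (v : V) :
    leftPart (insert (left v) σ) = insert v (leftPart σ) := by
  ext; simp

@[simp] lemma leftPart_insert_right (σ : Finset (JoinVertex V W)) (w : W) :
    leftPart (insert (right w) σ) = leftPart σ := by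
  ext; simp

@[simp] lemma rightPart_insert_left (σ : Finset (JoinVertex V W)) (v : V) :
    rightPart (insert (left v) σ) = rightPart σ := by
  ext; simp

@[simp] lemma rightPart_insert_right (σ : Finset (JoinVertex V W)) (w : W) :
    rightPart (insert (right w) σ) = insert w (rightPart σ) := by
  ext; simp

@[simp] lemma leftPart_erase_left (σ : Finset (JoinVertex V W)) (v : V) :
    leftPart (σ.erase (left v)) = (leftPart σ).erase v := by
  ext; simp

@[simp] lemma leftPart_erase_right (σ : Finset (JoinVertex V W)) (w : W) :
    leftPart (σ.erase (right w)) = leftPart σ := by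
  ext; simp

@[simp] lemma rightPart_erase_left (σ : Finset (JoinVertex V W)) (v : V) :
    rightPart (σ.erase (left v)) = rightPart σ := by
  ext; simp

@[simp] lemma rightPart_erase_right (σ : Finset (JoinVertex V W)) (w : W) :
    rightPart (σ.erase (right w)) = (rightPart σ).erase w := by
  ext; simp

@[simp] lemma leftPart_image_smul {H : Type} [Group H] [MulAction H V] (h : H)
    (σ : Finset (JoinVertex V W)) : leftPart (σ.image (h • ·)) = (leftPart σ).image (h • ·) := by
  ext v
  simp only [mem_leftPart, Finset.mem_image]
  constructor
  · rintro ⟨x, hx, e⟩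
    cases x with
    | left u => exact ⟨u, hx, JoinVertex.left.inj e⟩
    | right w => cases e
  · rintro ⟨u, hu, rfl⟩
    exact ⟨left u, hu, rfl⟩

@[simp] lemma rightPart_image_smul {H : Type} [Group H] [MulAction H V] (h : H)
    (σ : Finset (JoinVertex V W)) : rightPart (σ.image (h • ·)) = rightPart σ := by
  ext w
  simp only [mem_rightPart, Finset.mem_image]
  constructor
  · rintro ⟨x, hx, e⟩
    cases x with
    | left u => cases e
    | right w => cases e; exact hx
  · intro hw
    exact ⟨right w, hw, rfl⟩

end Parts

/-- `σ` spans a possibly empty simplex of `K`. -/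
def IsSimplex {V : Type} (K : AbstractSimplicialComplex V) (σ : Finset V) : Prop :=
  σ.Nonempty → σ ∈ K.faces

section IsSimplex

variable {V : Type} {K : AbstractSimplicialComplex V}

lemma nonempty_of_mem_faces {σ : Finset V} (h : σ ∈ K.faces) : σ.Nonempty :=
  (K.isRelLowerSet_faces h).1

lemma mem_faces_of_subset {σ τ : Finset V} (h : σ ∈ K.faces) (hτ : τ ⊆ σ) (hn : τ.Nonempty) :
    τ ∈ K.faces :=
  (K.isRelLowerSet_faces h).2 hτ hn

lemma isSimplex_of_mem_faces {σ : Finset V} (h : σ ∈ K.faces) : IsSimplex K σ := fun _ => h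

lemma IsSimplex.mono {σ τ : Finset V} (h : IsSimplex K σ) (hτ : τ ⊆ σ) : IsSimplex K τ :=
  fun hn => mem_faces_of_subset (h (hn.mono hτ)) hτ hn

end IsSimplex

section Join

variable {V W : Type} [Fintype V] [Fintype W] [LinearOrder V] [LinearOrder W]

/-- The join of two simplicial complexes. -/
def joinComplex (K : AbstractSimplicialComplex V) (L : AbstractSimplicialComplex W) :
    AbstractSimplicialComplex (JoinVertex V W) where
  faces := {σ | σ.Nonempty ∧ IsSimplex K (leftPart σ) ∧ IsSimplex L (rightPart σ)}
  isRelLowerSet_faces := by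
    rintro σ ⟨hn, h1, h2⟩
    refine ⟨hn, fun τ hτ hn' => ⟨hn', h1.mono fun v => ?_, h2.mono fun w => ?_⟩⟩
    · simpa using @hτ _
    · simpa using @hτ _
  singleton_mem x := by
    refine ⟨Finset.singleton_nonempty x, ?_, ?_⟩
    · rintro ⟨v, hv⟩
      obtain rfl : left v = x := by simpa using hv
      convert K.singleton_mem v
      ext; simp
    · rintro ⟨w, hw⟩
      obtain rfl : right w = x := by simpa using hw
      convert L.singleton_mem w
      ext; simp

variable {K : AbstractSimplicialComplex V} {L : AbstractSimplicialComplex W}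

lemma isInvariant_joinComplex {H : Type} [Group H] [MulAction H V] (hK : IsInvariant H K) :
    IsInvariant H (joinComplex K L) := by
  rintro h σ ⟨hn, h1, h2⟩
  refine ⟨hn.image _, ?_, ?_⟩
  · rw [leftPart_image_smul]
    exact fun hne => hK h _ (h1 (Finset.image_nonempty.1 hne))
  · rwa [rightPart_image_smul]

end Join

/-! ### Chains on the join -/

section TwistedChain

variable {V : Type} {K : AbstractSimplicialComplex V} {n : ℕ} {a : Finset V → Finset V → ℤ}

lemma neg_one_pow_mul_self (k : ℕ) : (-1 : ℤ) ^ k * (-1) ^ k = 1 := by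
  rw [← mul_pow]; simp

/-- For `p + q = n + 2` the exponents satisfy `(n + 1) + (p - 1)(q - 1) = pq`. The twist of the
coefficients turns the sign of `ι` into the Koszul sign for simplices graded by cardinality, the
grading that is additive under joins. -/
lemma twist_sign {p q n : ℕ} (hp : 0 < p) (hq : 0 < q) (h : p + q = n + 2) :
    (-1 : ℤ) ^ (n + 1) * (-1) ^ ((p - 1) * (q - 1)) = (-1) ^ (p * q) := by
  obtain ⟨p, rfl⟩ := Nat.exists_eq_succ_of_ne_zero hp.ne'
  obtain ⟨q, rfl⟩ := Nat.exists_eq_succ_of_ne_zero hq.ne'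
  obtain rfl : n = p + q := by omega
  rw [← pow_add]
  congr 1
  simp only [Nat.succ_eq_add_one, Nat.add_sub_cancel]
  ring

/-- In terms of cardinalities, the symmetry of a twisted chain is the Koszul sign. -/
lemma IsTwistedChain.koszul (h : IsTwistedChain K n a) (σ τ : Finset V) :
    a τ σ = (-1) ^ (σ.card * τ.card) * a σ τ := by
  by_cases h0 : a σ τ = 0
  · rw [h.symm σ τ, h0]; simp
  · obtain ⟨⟨h1, h2, -⟩, hc⟩ := h.support σ τ h0
    rw [h.symm σ τ, twist_sign (nonempty_of_mem_faces h1).card_pos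
      (nonempty_of_mem_faces h2).card_pos hc]

lemma IsTwistedChain.of_koszul
    (hs : ∀ σ τ, a σ τ ≠ 0 → IsConfigCell K σ τ ∧ σ.card + τ.card = n + 2)
    (hk : ∀ σ τ, a τ σ = (-1) ^ (σ.card * τ.card) * a σ τ) : IsTwistedChain K n a where
  support := hs
  symm σ τ := by
    by_cases h0 : a σ τ = 0
    · rw [hk, h0]; simp
    · obtain ⟨⟨h1, h2, -⟩, hc⟩ := hs σ τ h0
      rw [hk, twist_sign (nonempty_of_mem_faces h1).card_pos
        (nonempty_of_mem_faces h2).card_pos hc]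

lemma IsTwistedChain.empty_left (h : IsTwistedChain K n a) (τ : Finset V) : a ∅ τ = 0 := by
  by_contra h0
  exact Finset.not_nonempty_empty (nonempty_of_mem_faces (h.support _ _ h0).1.1)

lemma IsTwistedChain.empty_right (h : IsTwistedChain K n a) (σ : Finset V) : a σ ∅ = 0 := by
  by_contra h0
  exact Finset.not_nonempty_empty (nonempty_of_mem_faces (h.support _ _ h0).1.2.1)

lemma IsTwistedChain.cast_symm (h : IsTwistedChain K n a) (σ τ : Finset V) :
    (a τ σ : ZMod 2) = a σ τ := by
  rw [h.koszul σ τ]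
  have : (-1 : ZMod 2) = 1 := by decide
  push_cast
  rw [this]
  simp

end TwistedChain

/-! ### Evaluation cycles as cycles of the deleted join. -/

section Augmented

variable {V : Type} [Fintype V] [LinearOrder V] {K : AbstractSimplicialComplex V} {n : ℕ}
  {a : Finset V → Finset V → ℤ}

lemma IsEvaluationCycle.sum_vertex_right (h : IsEvaluationCycle K n a) (σ : Finset V) :
    ∑ v : V, a σ {v} = 0 := by
  by_cases hc : σ.card = n + 1
  · exact h.balanced σ hc
  · refine Finset.sum_eq_zero fun v _ => ?_
    by_contra h0
    have := (h.chain.support _ _ h0).2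
    simp only [Finset.card_singleton] at this
    omega

lemma IsEvaluationCycle.sum_vertex_left (h : IsEvaluationCycle K n a) (τ : Finset V) :
    ∑ v : V, a {v} τ = 0 := by
  simp_rw [h.chain.koszul τ, Finset.card_singleton, mul_one, ← Finset.mul_sum,
    h.sum_vertex_right τ, mul_zero]

/-- An evaluation cycle is also a cycle for the augmented boundary, where one of the two simplices
may be empty. -/
lemma IsEvaluationCycle.augmented_boundary (h : IsEvaluationCycle K n a) {ρ τ : Finset V}
    (hρ : IsSimplex K ρ) (hτ : IsSimplex K τ) (hd : Disjoint ρ τ) :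
    (∑ v ∈ Finset.univ \ ρ, incidence v ρ * a (insert v ρ) τ) -
      (-1) ^ ρ.card * ∑ v ∈ Finset.univ \ τ, incidence v τ * a ρ (insert v τ) = 0 := by
  -- If one simplex is empty, one sum runs over vertices and vanishes by the balance condition,
  -- while the other has only coefficients at empty simplices. If `ρ` is nonempty, `-(-1) ^ card` is
  -- the sign `(-1) ^ dim` in `boundary`.
  rcases ρ.eq_empty_or_nonempty with rfl | hρ'
  · simp [incidence, h.chain.empty_left, h.sum_vertex_left]
  rcases τ.eq_empty_or_nonempty with rfl | hτ'
  · simp [incidence, h.chain.empty_right, h.sum_vertex_right]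
  have := h.cycle ρ τ ⟨hρ hρ', hτ hτ', hd⟩
  rw [boundary] at this
  obtain ⟨k, hk⟩ := Nat.exists_eq_succ_of_ne_zero hρ'.card_pos.ne'
  rw [hk] at this ⊢
  simp only [Nat.succ_eq_add_one, Nat.add_sub_cancel] at this
  rw [← this, pow_succ]
  ring

end Augmented

section JoinChain

variable {V W : Type} [Fintype V] [Fintype W] [LinearOrder V] [LinearOrder W]
  {K : AbstractSimplicialComplex V} {L : AbstractSimplicialComplex W} {m n : ℕ}
  {a : Finset V → Finset V → ℤ} {b : Finset W → Finset W → ℤ}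

/-- The join of two chains: `(σ₁, τ₁) * (σ₂, τ₂) = ± (σ₁ * σ₂, τ₁ * τ₂)`. -/
def joinChain (a : Finset V → Finset V → ℤ) (b : Finset W → Finset W → ℤ)
    (σ τ : Finset (JoinVertex V W)) : ℤ :=
  (-1) ^ ((leftPart τ).card * (rightPart σ).card) *
    (a (leftPart σ) (leftPart τ) * b (rightPart σ) (rightPart τ))

lemma incidence_left (v : V) (ρ : Finset (JoinVertex V W)) :
    incidence (left v) ρ = incidence v (leftPart ρ) := by
  rw [incidence, incidence, card_parts]
  have h1 : leftPart (ρ.filter (· < left v)) = (leftPart ρ).filter (· < v) := by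
    ext; simp
  have h2 : rightPart (ρ.filter (· < left v)) = ∅ := by
    ext; simp
  rw [h1, h2]
  simp

/-- Every left vertex precedes `w`, which shifts its position by the size of the left part. -/
lemma incidence_right (w : W) (ρ : Finset (JoinVertex V W)) :
    incidence (right w) ρ = (-1) ^ (leftPart ρ).card * incidence w (rightPart ρ) := by
  rw [incidence, incidence, card_parts, ← pow_add]
  have h1 : leftPart (ρ.filter (· < right w)) = leftPart ρ := by
    ext; simp
  have h2 : rightPart (ρ.filter (· < right w)) = (rightPart ρ).filter (· < w) := by
    ext; simp
  rw [h1, h2]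

/-- Half of the Leibniz rule: a vertex is inserted on one side only, so the coefficient on the other
side factors out. The other half is `sum_incidence_second`. -/
lemma sum_incidence_first (ρ τ : Finset (JoinVertex V W)) :
    ∑ x ∈ Finset.univ \ ρ, incidence x ρ * joinChain a b (insert x ρ) τ =
      (-1) ^ ((leftPart τ).card * (rightPart ρ).card) * b (rightPart ρ) (rightPart τ) *
        (∑ v ∈ Finset.univ \ leftPart ρ,
          incidence v (leftPart ρ) * a (insert v (leftPart ρ)) (leftPart τ)) +
      (-1) ^ (leftPart ρ).card * (-1) ^ (leftPart τ).card *
        (-1) ^ ((leftPart τ).card * (rightPart ρ).card) * a (leftPart ρ) (leftPart τ) *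
        (∑ w ∈ Finset.univ \ rightPart ρ,
          incidence w (rightPart ρ) * b (insert w (rightPart ρ)) (rightPart τ)) := by
  rw [sum_parts, leftPart_univ_sdiff, rightPart_univ_sdiff, Finset.mul_sum, Finset.mul_sum]
  congr 1
  · refine Finset.sum_congr rfl fun v _ => ?_
    simp only [joinChain, incidence_left, leftPart_insert_left, rightPart_insert_left]
    ring
  · refine Finset.sum_congr rfl fun w hw => ?_
    simp only [joinChain, incidence_right, leftPart_insert_right, rightPart_insert_right]
    rw [Finset.card_insert_of_notMem (Finset.mem_sdiff.1 hw).2]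
    ring

lemma sum_incidence_second (ρ τ : Finset (JoinVertex V W)) :
    ∑ x ∈ Finset.univ \ τ, incidence x τ * joinChain a b ρ (insert x τ) =
      (-1) ^ (rightPart ρ).card * (-1) ^ ((leftPart τ).card * (rightPart ρ).card) *
        b (rightPart ρ) (rightPart τ) *
        (∑ v ∈ Finset.univ \ leftPart τ,
          incidence v (leftPart τ) * a (leftPart ρ) (insert v (leftPart τ))) +
      (-1) ^ (leftPart τ).card *
        (-1) ^ ((leftPart τ).card * (rightPart ρ).card) * a (leftPart ρ) (leftPart τ) *
        (∑ w ∈ Finset.univ \ rightPart τ,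
          incidence w (rightPart τ) * b (rightPart ρ) (insert w (rightPart τ))) := by
  rw [sum_parts, leftPart_univ_sdiff, rightPart_univ_sdiff, Finset.mul_sum, Finset.mul_sum]
  congr 1
  · refine Finset.sum_congr rfl fun v hv => ?_
    simp only [joinChain, incidence_left, leftPart_insert_left, rightPart_insert_left]
    rw [Finset.card_insert_of_notMem (Finset.mem_sdiff.1 hv).2]
    ring
  · refine Finset.sum_congr rfl fun w hw => ?_
    simp only [joinChain, incidence_right, leftPart_insert_right, rightPart_insert_right]
    ring

/-- The sign in `joinChain` comes from moving `τ₁` past `σ₂`, from `(σ₁, τ₁), (σ₂, τ₂)` to `(σ₁σ₂,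
τ₁τ₂)`. The Koszul sign of the exchange splits into four factors: two belong to `a` and `b`, and the
mixed ones account for the change of the sign in `joinChain`. -/
lemma IsTwistedChain.join (ha : IsTwistedChain K m a) (hb : IsTwistedChain L n b) :
    IsTwistedChain (joinComplex K L) (m + n + 2) (joinChain a b) := by
  refine .of_koszul (fun σ τ h0 => ?_) (fun σ τ => ?_)
  · have h1 := right_ne_zero_of_mul h0
    obtain ⟨⟨hσ, hτ, hd⟩, hc⟩ := ha.support _ _ (left_ne_zero_of_mul h1)
    obtain ⟨⟨hσ', hτ', hd'⟩, hc'⟩ := hb.support _ _ (right_ne_zero_of_mul h1)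
    refine ⟨⟨⟨nonempty_of_leftPart (nonempty_of_mem_faces hσ), fun _ => hσ, fun _ => hσ'⟩,
      ⟨nonempty_of_leftPart (nonempty_of_mem_faces hτ), fun _ => hτ, fun _ => hτ'⟩,
      disjoint_of_parts hd hd'⟩, ?_⟩
    rw [card_parts σ, card_parts τ]
    omega
  · rw [joinChain, joinChain, ha.koszul (leftPart σ), hb.koszul (rightPart σ), card_parts σ,
      card_parts τ, add_mul, mul_add, mul_add, pow_add, pow_add, pow_add,
      mul_comm (leftPart τ).card (rightPart σ).card]
    linear_combination (-(-1) ^ ((leftPart σ).card * (rightPart τ).card) *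
      (-1) ^ ((leftPart σ).card * (leftPart τ).card) * a (leftPart σ) (leftPart τ) *
      ((-1) ^ ((rightPart σ).card * (rightPart τ).card) * b (rightPart σ) (rightPart τ))) *
      neg_one_pow_mul_self ((rightPart σ).card * (leftPart τ).card)

/-- By the Leibniz rule this is a combination of the boundaries of `a` and `b`. They must be the
augmented ones, because a nonempty simplex of the join may have an empty part. -/
lemma IsEvaluationCycle.boundary_join (ha : IsEvaluationCycle K m a)
    (hb : IsEvaluationCycle L n b) {ρ τ : Finset (JoinVertex V W)}
    (h : IsConfigCell (joinComplex K L) ρ τ) : boundary (joinChain a b) ρ τ = 0 := by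
  obtain ⟨⟨hρ, hρ1, hρ2⟩, ⟨-, hτ1, hτ2⟩, hd⟩ := h
  obtain ⟨hd1, hd2⟩ := disjoint_parts hd
  have h1 := ha.augmented_boundary hρ1 hτ1 hd1
  have h2 := hb.augmented_boundary hρ2 hτ2 hd2
  rw [boundary, sum_incidence_first, sum_incidence_second]
  have hs : (-1 : ℤ) ^ (ρ.card - 1) = -((-1) ^ (leftPart ρ).card * (-1) ^ (rightPart ρ).card) := by
    rw [← pow_add, ← card_parts]
    obtain ⟨k, hk⟩ := Nat.exists_eq_succ_of_ne_zero hρ.card_pos.ne'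
    rw [hk, Nat.succ_eq_add_one, Nat.add_sub_cancel, pow_succ]
    ring
  rw [hs]
  have hy := neg_one_pow_mul_self (rightPart ρ).card
  generalize (∑ v ∈ Finset.univ \ leftPart ρ,
    incidence v (leftPart ρ) * a (insert v (leftPart ρ)) (leftPart τ)) = S1 at *
  generalize (∑ v ∈ Finset.univ \ leftPart τ,
    incidence v (leftPart τ) * a (leftPart ρ) (insert v (leftPart τ))) = S1' at *
  generalize (∑ w ∈ Finset.univ \ rightPart ρ,
    incidence w (rightPart ρ) * b (insert w (rightPart ρ)) (rightPart τ)) = S2 at *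
  generalize (∑ w ∈ Finset.univ \ rightPart τ,
    incidence w (rightPart τ) * b (rightPart ρ) (insert w (rightPart τ))) = S2' at *
  generalize (-1 : ℤ) ^ ((leftPart τ).card * (rightPart ρ).card) = e
  generalize (-1 : ℤ) ^ (leftPart τ).card = t
  generalize (-1 : ℤ) ^ (leftPart ρ).card = x at *
  generalize (-1 : ℤ) ^ (rightPart ρ).card = y at *
  linear_combination (e * b (rightPart ρ) (rightPart τ)) * h1 +
    (x * t * e * a (leftPart ρ) (leftPart τ)) * h2 -
    (x * e * b (rightPart ρ) (rightPart τ) * S1') * hy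

/-- A coefficient of the join vanishes when any of the four parts is empty, and a vertex has an
empty part. The balance condition thus holds term by term. -/
lemma IsTwistedChain.join_vertex (ha : IsTwistedChain K m a) (hb : IsTwistedChain L n b)
    (σ : Finset (JoinVertex V W)) (x : JoinVertex V W) : joinChain a b σ {x} = 0 := by
  cases x with
  | left v =>
    have : rightPart ({left v} : Finset (JoinVertex V W)) = ∅ := by ext; simp
    simp [joinChain, this, hb.empty_right]
  | right w =>
    have : leftPart ({right w} : Finset (JoinVertex V W)) = ∅ := by ext; simp
    simp [joinChain, this, ha.empty_right]

/-! ### The action of the group -/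

/-- Right vertices are fixed and follow all left vertices, so `h` creates inversions only among left
vertices. -/
lemma orientSign_join {H : Type} [Group H] [MulAction H V] (h : H)
    (ρ : Finset (JoinVertex V W)) : orientSign h ρ = orientSign h (leftPart ρ) := by
  have : ((ρ ×ˢ ρ).filter fun p => p.1 < p.2 ∧ h • p.2 < h • p.1) =
      ((leftPart ρ ×ˢ leftPart ρ).filter fun p => p.1 < p.2 ∧ h • p.2 < h • p.1).image
        (Prod.map left left) := by
    ext ⟨x, y⟩
    cases x <;> cases y <;> (simp; try (intros; order))
  have hi : Function.Injective (Prod.map (left : V → JoinVertex V W) (left : V → JoinVertex V W)) :=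
    Function.Injective.prodMap (fun _ _ => JoinVertex.left.inj) (fun _ _ => JoinVertex.left.inj)
  rw [orientSign, orientSign, this, Finset.card_image_of_injective _ hi]

lemma pushforward_join {H : Type} [Group H] [MulAction H V] (h : H)
    (σ τ : Finset (JoinVertex V W)) :
    pushforward h (joinChain a b) σ τ =
      (-1) ^ ((leftPart τ).card * (rightPart σ).card) *
        (pushforward h a (leftPart σ) (leftPart τ) * b (rightPart σ) (rightPart τ)) := by
  simp only [pushforward, joinChain, orientSign_join, leftPart_image_smul, rightPart_image_smul,
    Finset.card_image_of_injective _ (MulAction.injective h⁻¹)]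
  ring

end JoinChain

/-! ### The van Kampen class of the join -/

section Cochain

variable {V : Type} [DecidableEq V]

/-- The first coordinate of an equivariant chain map to `S^∞`, extended to the deleted join of `K`,
whose cells are the pairs of disjoint and possibly empty simplices. -/
structure IsDeletedJoinCochain (K : AbstractSimplicialComplex V)
    (x : Finset V → Finset V → ZMod 2) : Prop where
  empty_empty : x ∅ ∅ = 1
  empty_left : ∀ τ : Finset V, τ.Nonempty → x ∅ τ = 0
  singleton_empty : ∀ v, x {v} ∅ = 1
  empty_right : ∀ σ : Finset V, 2 ≤ σ.card → x σ ∅ = 0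
  coboundary : ∀ σ τ, IsSimplex K σ → IsSimplex K τ → Disjoint σ τ →
    ∑ v ∈ σ, x (σ.erase v) τ + ∑ v ∈ τ, x σ (τ.erase v) = x σ τ + x τ σ

/-- The extension to the deleted join. -/
def extendCochain (φ : Finset V → Finset V → ZMod 2 × ZMod 2) (σ τ : Finset V) : ZMod 2 :=
  if σ = ∅ then (if τ = ∅ then 1 else 0)
  else if τ = ∅ then (if σ.card = 1 then 1 else 0) else (φ σ τ).1

lemma extendCochain_of_nonempty (φ : Finset V → Finset V → ZMod 2 × ZMod 2) {σ τ : Finset V}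
    (hσ : σ.Nonempty) (hτ : τ.Nonempty) : extendCochain φ σ τ = (φ σ τ).1 := by
  simp [extendCochain, hσ.ne_empty, hτ.ne_empty]

lemma zmod_two_add_self (x : ZMod 2) : x + x = 0 := CharTwo.add_self_eq_zero x

lemma erase_nonempty_iff {σ : Finset V} {v : V} (hv : v ∈ σ) :
    (σ.erase v).Nonempty ↔ 2 ≤ σ.card := by
  rw [← Finset.card_pos, Finset.card_erase_of_mem hv]
  omega

lemma sum_filter_erase_nonempty {σ : Finset V} (F : V → ZMod 2)
    (h : ∀ v ∈ σ, σ.erase v = ∅ → F v = 0) :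
    ∑ v ∈ σ.filter (fun v => (σ.erase v).Nonempty), F v = ∑ v ∈ σ, F v := by
  refine Finset.sum_filter_of_ne fun v hv hF => ?_
  rw [Finset.nonempty_iff_ne_empty]
  exact fun h0 => hF (h v hv h0)

/-- A product cell has one dimension more in the deleted join, so `φ` is used with a shift by one.
The copies `K * ∅` and `∅ * K` are collapsed to the two vertices of `S^∞`; the edge `({v}, {w})`
then joins these vertices, which is what `augmentation` expresses. -/
lemma IsClassifyingMap.isDeletedJoinCochain {K : AbstractSimplicialComplex V}
    {φ : Finset V → Finset V → ZMod 2 × ZMod 2} (h : IsClassifyingMap K φ) :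
    IsDeletedJoinCochain K (extendCochain φ) where
  empty_empty := by simp [extendCochain]
  empty_left τ hτ := by simp [extendCochain, hτ.ne_empty]
  singleton_empty v := by simp [extendCochain]
  empty_right σ hσ := by
    have : σ ≠ ∅ := by rintro rfl; simp at hσ
    simp [extendCochain, this]
    omega
  coboundary σ τ hσ hτ hd := by
    have empty_case : ∀ ρ : Finset V, ρ.Nonempty →
        (∑ v ∈ ρ, extendCochain φ ∅ (ρ.erase v) = extendCochain φ ρ ∅) ∧
        (∑ v ∈ ρ, extendCochain φ (ρ.erase v) ∅ = extendCochain φ ρ ∅) := by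
      intro ρ hρ
      rcases Nat.lt_or_ge ρ.card 2 with hc | hc
      · obtain ⟨v, rfl⟩ := Finset.card_eq_one.1 (le_antisymm (by omega) hρ.card_pos)
        simp only [Finset.sum_singleton]
        simp [extendCochain]
      · have h0 : extendCochain φ ρ ∅ = 0 := by
          simp [extendCochain, hρ.ne_empty]; omega
        rw [h0]
        constructor
        · refine Finset.sum_eq_zero fun v hv => ?_
          have := ((erase_nonempty_iff hv).2 hc).ne_empty
          simp only [extendCochain, if_pos, this, if_false]
        -- Only an edge has facets with a nonzero value, and there are two of them.
        · have : ∀ v ∈ ρ, extendCochain φ (ρ.erase v) ∅ = if ρ.card = 2 then 1 else 0 := by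
            intro v hv
            have := ((erase_nonempty_iff hv).2 hc).ne_empty
            simp only [extendCochain, if_pos, this, if_false, Finset.card_erase_of_mem hv]
            congr 1
            simp only [eq_iff_iff]; omega
          rw [Finset.sum_congr rfl this, Finset.sum_const]
          split_ifs with h2
          · rw [h2]; decide
          · simp
    rcases σ.eq_empty_or_nonempty with rfl | hσ'
    · rcases τ.eq_empty_or_nonempty with rfl | hτ'
      · simp [zmod_two_add_self]
      · have h0 : extendCochain φ ∅ τ = 0 := by simp [extendCochain, hτ'.ne_empty]
        rw [h0, (empty_case τ hτ').1]
        simp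
    rcases τ.eq_empty_or_nonempty with rfl | hτ'
    · have h0 : extendCochain φ ∅ σ = 0 := by simp [extendCochain, hσ'.ne_empty]
      rw [h0, (empty_case σ hσ').2]
      simp
    have hcell : IsConfigCell K σ τ := ⟨hσ hσ', hτ hτ', hd⟩
    have hswap : (φ τ σ).1 = (φ σ τ).2 := by rw [h.equivariant σ τ hcell]; rfl
    rw [extendCochain_of_nonempty φ hσ' hτ', extendCochain_of_nonempty φ hτ' hσ', hswap]
    rcases Nat.lt_or_ge (σ.card + τ.card) 3 with hc | hc
    · have := hσ'.card_pos
      have := hτ'.card_pos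
      obtain ⟨v, rfl⟩ := Finset.card_eq_one.1 (show σ.card = 1 by omega)
      obtain ⟨w, rfl⟩ := Finset.card_eq_one.1 (show τ.card = 1 by omega)
      rw [h.augmentation v w hcell]
      simp [extendCochain]
    · have hm := congrArg Prod.fst (h.chain_map σ τ hcell hc)
      rw [Prod.fst_add, Prod.fst_sum, Prod.fst_sum] at hm
      refine Eq.trans ?_ hm
      congr 1
      · rw [← sum_filter_erase_nonempty]
        · refine Finset.sum_congr rfl fun v hv => ?_
          exact extendCochain_of_nonempty φ (Finset.mem_filter.1 hv).2 hτ'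
        · intro v _ h0
          simp [h0, extendCochain, hτ'.ne_empty]
      · rw [← sum_filter_erase_nonempty]
        · refine Finset.sum_congr rfl fun v hv => ?_
          exact extendCochain_of_nonempty φ hσ' (Finset.mem_filter.1 hv).2
        · intro v hv h0
          have : ¬ 2 ≤ τ.card := by
            rw [← erase_nonempty_iff hv, h0]; simp
          have hσc : σ.card ≠ 1 := by omega
          simp [h0, extendCochain, hσ'.ne_empty, hσc]

/-- The equivariant chain map to `S^∞` with a given first coordinate. -/
def classifyingMap (x : Finset V → Finset V → ZMod 2) (σ τ : Finset V) : ZMod 2 × ZMod 2 :=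
  (x σ τ, x τ σ)

lemma IsDeletedJoinCochain.isClassifyingMap {K : AbstractSimplicialComplex V}
    {x : Finset V → Finset V → ZMod 2} (h : IsDeletedJoinCochain K x) :
    IsClassifyingMap K (classifyingMap x) where
  equivariant σ τ _ := rfl
  augmentation v w hc := by
    have := h.coboundary {v} {w} (isSimplex_of_mem_faces hc.1) (isSimplex_of_mem_faces hc.2.1)
      hc.2.2
    rw [classifyingMap, ← this]
    simp [h.empty_left, h.singleton_empty]
  chain_map := by
    have key : ∀ σ τ, IsConfigCell K σ τ → 3 ≤ σ.card + τ.card →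
        ∑ v ∈ σ.filter (fun v => (σ.erase v).Nonempty), x (σ.erase v) τ +
          ∑ v ∈ τ.filter (fun v => (τ.erase v).Nonempty), x σ (τ.erase v) = x σ τ + x τ σ := by
      intro σ τ hc h3
      have hσ' := nonempty_of_mem_faces hc.1
      have hτ' := nonempty_of_mem_faces hc.2.1
      -- The terms with an empty simplex, which the filters omit, are zero: `x ∅ τ` always, and `x σ
      -- ∅` because `3 ≤ σ.card + τ.card` forces `2 ≤ σ.card`.
      rw [← h.coboundary σ τ (isSimplex_of_mem_faces hc.1) (isSimplex_of_mem_faces hc.2.1) hc.2.2,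
        sum_filter_erase_nonempty, sum_filter_erase_nonempty]
      · intro v hv h0
        have : ¬ 2 ≤ τ.card := by
          rw [← erase_nonempty_iff hv, h0]; simp
        rw [h0]
        exact h.empty_right σ (by omega)
      · intro v _ h0
        rw [h0]
        exact h.empty_left τ hτ'
    intro σ τ hc h3
    refine Prod.ext ?_ ?_
    · rw [Prod.fst_add, Prod.fst_sum, Prod.fst_sum]
      exact key σ τ hc h3
    · rw [Prod.snd_add, Prod.snd_sum, Prod.snd_sum, add_comm]
      refine (key τ σ ⟨hc.2.1, hc.1, hc.2.2.symm⟩ (by omega)).trans ?_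
      exact add_comm _ _

end Cochain

/-! ### Multiplicativity of the van Kampen pairing. -/

section Join

variable {V W : Type} [Fintype V] [Fintype W] [LinearOrder V] [LinearOrder W]
  {K : AbstractSimplicialComplex V} {L : AbstractSimplicialComplex W}

/-- The join of two equivariant maps to `S^∞`. -/
def joinCochain (x : Finset V → Finset V → ZMod 2) (y : Finset W → Finset W → ZMod 2)
    (σ τ : Finset (JoinVertex V W)) : ZMod 2 :=
  x (leftPart σ) (leftPart τ) *
    if Even ((leftPart σ).card + (leftPart τ).card) then y (rightPart σ) (rightPart τ)
    else y (rightPart τ) (rightPart σ)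

/-- Write `x'`, `y'` for the values after exchanging the two simplices. Erasing a left vertex
changes the parity and hence exchanges `y` with `y'`. In even degree the coboundary is `(x + x') y'
+ x (y + y') = x y + x' y'` modulo 2, as required; in odd degree `y` and `y'` trade places. -/
lemma IsDeletedJoinCochain.join {x : Finset V → Finset V → ZMod 2}
    {y : Finset W → Finset W → ZMod 2} (hx : IsDeletedJoinCochain K x)
    (hy : IsDeletedJoinCochain L y) :
    IsDeletedJoinCochain (joinComplex K L) (joinCochain x y) where
  empty_empty := by simp [joinCochain, hx.empty_empty, hy.empty_empty]
  empty_left τ hτ := by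
    rcases (leftPart τ).eq_empty_or_nonempty with h1 | h1
    · have h2 : (rightPart τ).Nonempty := by
        rw [Finset.nonempty_iff_ne_empty]
        exact fun h2 => hτ.ne_empty ((eq_empty_iff_parts τ).2 ⟨h1, h2⟩)
      simp [joinCochain, h1, hy.empty_left _ h2]
    · simp [joinCochain, hx.empty_left _ h1]
  singleton_empty z := by
    cases z with
    | left v =>
      have h1 : leftPart ({left v} : Finset (JoinVertex V W)) = {v} := by ext; simp
      have h2 : rightPart ({left v} : Finset (JoinVertex V W)) = ∅ := by ext; simp
      simp [joinCochain, h1, h2, hx.singleton_empty, hy.empty_empty]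
    | right w =>
      have h1 : leftPart ({right w} : Finset (JoinVertex V W)) = ∅ := by ext; simp
      have h2 : rightPart ({right w} : Finset (JoinVertex V W)) = {w} := by ext; simp
      simp [joinCochain, h1, h2, hx.empty_empty, hy.singleton_empty]
  empty_right σ hσ := by
    rw [card_parts] at hσ
    rcases Nat.lt_or_ge (leftPart σ).card 2 with hc | hc
    · rcases Nat.lt_or_ge (leftPart σ).card 1 with h1 | h1
      · have h0 : (leftPart σ).card = 0 := by omega
        simp [joinCochain, h0, hy.empty_right (rightPart σ) (by omega)]
      · have h1 : (leftPart σ).card = 1 := by omega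
        simp [joinCochain, h1, hy.empty_left (rightPart σ) (Finset.card_pos.1 (by omega))]
    · simp [joinCochain, hx.empty_right _ hc]
  coboundary σ τ hσ hτ hd := by
    obtain ⟨hd1, hd2⟩ := disjoint_parts hd
    have hl : ∀ {ρ}, IsSimplex (joinComplex K L) ρ → IsSimplex K (leftPart ρ) := fun h hn =>
      (h (nonempty_of_leftPart hn)).2.1 hn
    have hr : ∀ {ρ}, IsSimplex (joinComplex K L) ρ → IsSimplex L (rightPart ρ) := by
      rintro ρ h ⟨w, hw⟩
      exact (h ⟨_, mem_rightPart.1 hw⟩).2.2 ⟨w, hw⟩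
    have h1 := hx.coboundary _ _ (hl hσ) (hl hτ) hd1
    have h2 := hy.coboundary _ _ (hr hσ) (hr hτ) hd2
    have h2' := hy.coboundary _ _ (hr hτ) (hr hσ) hd2.symm
    rw [sum_parts, sum_parts]
    simp only [joinCochain, leftPart_erase_left, leftPart_erase_right, rightPart_erase_left,
      rightPart_erase_right]
    rw [← Finset.mul_sum, ← Finset.mul_sum, add_comm (leftPart τ).card]
    have e1 : ∀ v ∈ leftPart σ, (Even (((leftPart σ).erase v).card + (leftPart τ).card) ↔
        ¬ Even ((leftPart σ).card + (leftPart τ).card)) := by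
      intro v hv
      have := Finset.card_pos.2 ⟨v, hv⟩
      rw [Finset.card_erase_of_mem hv, Nat.even_iff, Nat.even_iff]
      omega
    have e2 : ∀ v ∈ leftPart τ, (Even ((leftPart σ).card + ((leftPart τ).erase v).card) ↔
        ¬ Even ((leftPart σ).card + (leftPart τ).card)) := by
      intro v hv
      have := Finset.card_pos.2 ⟨v, hv⟩
      rw [Finset.card_erase_of_mem hv, Nat.even_iff, Nat.even_iff]
      omega
    have s1 : ∀ v ∈ leftPart σ, (x ((leftPart σ).erase v) (leftPart τ) *
        if Even (((leftPart σ).erase v).card + (leftPart τ).card)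
          then y (rightPart σ) (rightPart τ) else y (rightPart τ) (rightPart σ)) =
        x ((leftPart σ).erase v) (leftPart τ) *
        if Even ((leftPart σ).card + (leftPart τ).card)
          then y (rightPart τ) (rightPart σ) else y (rightPart σ) (rightPart τ) := by
      intro v hv
      simp only [e1 v hv, ite_not]
    have s2 : ∀ v ∈ leftPart τ, (x (leftPart σ) ((leftPart τ).erase v) *
        if Even ((leftPart σ).card + ((leftPart τ).erase v).card)
          then y (rightPart σ) (rightPart τ) else y (rightPart τ) (rightPart σ)) =
        x (leftPart σ) ((leftPart τ).erase v) *
        if Even ((leftPart σ).card + (leftPart τ).card)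
          then y (rightPart τ) (rightPart σ) else y (rightPart σ) (rightPart τ) := by
      intro v hv
      simp only [e2 v hv, ite_not]
    rw [Finset.sum_congr rfl s1, Finset.sum_congr rfl s2, ← Finset.sum_mul, ← Finset.sum_mul]
    have two : (2 : ZMod 2) = 0 := by decide
    by_cases he : Even ((leftPart σ).card + (leftPart τ).card)
    · simp only [he, if_true]
      linear_combination y (rightPart τ) (rightPart σ) * h1 + x (leftPart σ) (leftPart τ) * h2 +
        x (leftPart σ) (leftPart τ) * y (rightPart τ) (rightPart σ) * two
    · simp only [he, if_false]
      linear_combination y (rightPart σ) (rightPart τ) * h1 + x (leftPart σ) (leftPart τ) * h2' +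
        x (leftPart σ) (leftPart τ) * y (rightPart σ) (rightPart τ) * two

lemma min_lt_min_iff {U : Type} [LinearOrder U] {s t : Finset U} :
    s.min < t.min ↔ ∃ x ∈ s, ∀ y ∈ t, x < y := by
  constructor
  · intro h
    obtain ⟨x, hx⟩ := Finset.min_of_nonempty (s := s)
      (by rw [Finset.nonempty_iff_ne_empty]; rintro rfl; simp at h)
    refine ⟨x, Finset.mem_of_min hx, fun y hy => ?_⟩
    rw [hx] at h
    exact WithTop.coe_lt_coe.1 (h.trans_le (Finset.min_le hy))
  · rintro ⟨x, hx, h⟩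
    refine (Finset.min_le hx).trans_lt ?_
    rw [Finset.min, Finset.lt_inf_iff (WithTop.coe_lt_top x)]
    exact fun y hy => WithTop.coe_lt_coe.2 (h y hy)

/-- Left vertices come first, so the chosen representatives of unordered cells of the join consist
of a chosen representative on the left and an arbitrary ordered pair on the right. -/
lemma min_lt_min_join {σ τ : Finset (JoinVertex V W)} (hτ : (leftPart τ).Nonempty) :
    σ.min < τ.min ↔ (leftPart σ).min < (leftPart τ).min := by
  rw [min_lt_min_iff, min_lt_min_iff]
  constructor
  · rintro ⟨x, hx, h⟩
    obtain ⟨u, hu⟩ := hτ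
    cases x with
    | left v =>
      refine ⟨v, mem_leftPart.2 hx, fun w hw => left_lt_left.1 (h _ (mem_leftPart.1 hw))⟩
    | right w => exact absurd (h _ (mem_leftPart.1 hu)) not_right_lt_left
  · rintro ⟨v, hv, h⟩
    refine ⟨left v, mem_leftPart.1 hv, fun y hy => ?_⟩
    cases y with
    | left u => exact left_lt_left.2 (h u (mem_leftPart.2 hy))
    | right w => exact left_lt_right

/-- The pairing as a sum over the ordered configuration space. -/
lemma sum_mul_eq_vkPairing {n : ℕ} {a : Finset V → Finset V → ℤ} (ha : IsTwistedChain K n a)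
    (x : Finset V → Finset V → ZMod 2) :
    ∑ σ, ∑ τ, (a σ τ : ZMod 2) * x σ τ = vkPairing (classifyingMap x) a := by
  -- Disjoint simplices have different smallest vertices. Exchanging the names in the second summand
  -- lets each unordered cell contribute `x σ τ + x τ σ`.
  have h1 : ∀ σ τ, (a σ τ : ZMod 2) * x σ τ =
      (if σ.min < τ.min then (a σ τ : ZMod 2) * x σ τ else 0) +
      (if τ.min < σ.min then (a σ τ : ZMod 2) * x σ τ else 0) := by
    intro σ τ
    by_cases h0 : a σ τ = 0
    · simp [h0]
    obtain ⟨⟨hσ, -, hd⟩, -⟩ := ha.support σ τ h0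
    rcases lt_trichotomy σ.min τ.min with h | h | h
    · simp [h, h.asymm]
    · obtain ⟨v, hv⟩ := Finset.min_of_nonempty (nonempty_of_mem_faces hσ)
      exact absurd (Finset.mem_of_min (h ▸ hv))
        (Finset.disjoint_left.1 hd (Finset.mem_of_min hv))
    · simp [h, h.asymm]
  rw [Finset.sum_congr rfl fun σ _ => Finset.sum_congr rfl fun τ _ => h1 σ τ]
  simp_rw [Finset.sum_add_distrib]
  rw [Finset.sum_comm (f := fun σ τ => if τ.min < σ.min then (a σ τ : ZMod 2) * x σ τ else 0),
    ← Finset.sum_add_distrib, vkPairing]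
  refine Finset.sum_congr rfl fun σ _ => ?_
  rw [← Finset.sum_add_distrib]
  refine Finset.sum_congr rfl fun τ _ => ?_
  rw [ha.cast_symm σ τ]
  split_ifs
  · rw [classifyingMap, mul_add]
  · simp

lemma vkPairing_congr {n : ℕ} {a : Finset V → Finset V → ℤ} (ha : IsTwistedChain K n a)
    {φ : Finset V → Finset V → ZMod 2 × ZMod 2} (hφ : IsClassifyingMap K φ) :
    vkPairing (classifyingMap (extendCochain φ)) a = vkPairing φ a := by
  refine Finset.sum_congr rfl fun σ _ => Finset.sum_congr rfl fun τ _ => ?_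
  by_cases h0 : a σ τ = 0
  · simp [h0]
  have hc := (ha.support σ τ h0).1
  have hσ := nonempty_of_mem_faces hc.1
  have hτ := nonempty_of_mem_faces hc.2.1
  rw [classifyingMap, extendCochain_of_nonempty φ hσ hτ, extendCochain_of_nonempty φ hτ hσ,
    hφ.equivariant σ τ hc]
  rfl

/-- For a fixed unordered left cell, the sum over ordered right cells gives the pairing of `b`,
whether `y` is evaluated at `(σ₂, τ₂)` or `(τ₂, σ₂)`. What remains is the pairing of `a`. -/
lemma vkPairing_join {m n : ℕ} {a : Finset V → Finset V → ℤ} {b : Finset W → Finset W → ℤ}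
    (ha : IsTwistedChain K m a) (hb : IsTwistedChain L n b)
    (x : Finset V → Finset V → ZMod 2) (y : Finset W → Finset W → ZMod 2) :
    vkPairing (classifyingMap (joinCochain x y)) (joinChain a b) =
      vkPairing (classifyingMap x) a * vkPairing (classifyingMap y) b := by
  have hy : ∑ σ, ∑ τ, (b σ τ : ZMod 2) * y τ σ = vkPairing (classifyingMap y) b := by
    rw [← sum_mul_eq_vkPairing hb, Finset.sum_comm]
    exact Finset.sum_congr rfl fun τ _ => Finset.sum_congr rfl fun σ _ => by rw [hb.cast_symm]
  have hneg : (-1 : ZMod 2) = 1 := by decide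
  rw [vkPairing, sum_finset_join, vkPairing, Finset.sum_mul]
  refine Finset.sum_congr rfl fun σ₁ _ => ?_
  rw [Finset.sum_congr rfl fun σ₂ _ => sum_finset_join (V := V) (W := W) _, Finset.sum_comm,
    Finset.sum_mul]
  refine Finset.sum_congr rfl fun τ₁ _ => ?_
  by_cases h0 : a σ₁ τ₁ = 0
  · simp [joinChain, h0]
  have hτ := nonempty_of_mem_faces (ha.support σ₁ τ₁ h0).1.2.1
  have hm : ∀ σ₂ τ₂, ((partsEquiv V W).symm (σ₁, σ₂)).min < ((partsEquiv V W).symm (τ₁, τ₂)).min ↔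
      σ₁.min < τ₁.min := by
    intro σ₂ τ₂
    rw [min_lt_min_join (by simpa using hτ)]
    simp
  simp only [hm]
  split_ifs
  · simp only [joinChain, classifyingMap, joinCochain, leftPart_partsEquiv_symm,
      rightPart_partsEquiv_symm]
    push_cast
    rw [hneg]
    simp only [one_pow, one_mul, add_comm τ₁.card]
    have hy' := sum_mul_eq_vkPairing hb y
    by_cases he : Even (σ₁.card + τ₁.card)
    · simp only [he, if_true]
      calc _ = ∑ σ₂, ∑ τ₂, ((a σ₁ τ₁ : ZMod 2) * x σ₁ τ₁ * (b σ₂ τ₂ * y σ₂ τ₂) +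
            (a σ₁ τ₁ : ZMod 2) * x τ₁ σ₁ * (b σ₂ τ₂ * y τ₂ σ₂)) :=
            Finset.sum_congr rfl fun _ _ => Finset.sum_congr rfl fun _ _ => by ring
        _ = _ := by
            simp_rw [Finset.sum_add_distrib, ← Finset.mul_sum, hy, hy']
            ring
    · simp only [he, if_false]
      calc _ = ∑ σ₂, ∑ τ₂, ((a σ₁ τ₁ : ZMod 2) * x σ₁ τ₁ * (b σ₂ τ₂ * y τ₂ σ₂) +
            (a σ₁ τ₁ : ZMod 2) * x τ₁ σ₁ * (b σ₂ τ₂ * y σ₂ τ₂)) :=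
            Finset.sum_congr rfl fun _ _ => Finset.sum_congr rfl fun _ _ => by ring
        _ = _ := by
            simp_rw [Finset.sum_add_distrib, ← Finset.mul_sum, hy, hy']
            ring
  · simp

/-- The join of two evaluation cycles is an evaluation cycle. -/
theorem IsEvaluationCycle.join {m n : ℕ} {a : Finset V → Finset V → ℤ}
    {b : Finset W → Finset W → ℤ} (ha : IsEvaluationCycle K m a) (hb : IsEvaluationCycle L n b) :
    IsEvaluationCycle (joinComplex K L) (m + n + 2) (joinChain a b) where
  chain := ha.chain.join hb.chain
  cycle _ _ h := ha.boundary_join hb h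
  vk_ne_zero := by
    obtain ⟨φ, hφ, hφ'⟩ := ha.vk_ne_zero
    obtain ⟨ψ, hψ, hψ'⟩ := hb.vk_ne_zero
    refine ⟨_, (hφ.isDeletedJoinCochain.join hψ.isDeletedJoinCochain).isClassifyingMap, ?_⟩
    rw [vkPairing_join ha.chain hb.chain, vkPairing_congr ha.chain hφ, vkPairing_congr hb.chain hψ]
    exact mul_ne_zero hφ' hψ'
  balanced σ _ := Finset.sum_eq_zero fun x _ => ha.chain.join_vertex hb.chain σ x

/-- The join of an equivariant obstructor and a complex with an evaluation cycle is an equivariant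
obstructor. -/
theorem IsEquivariantObstructor.join {H : Type} [Group H] [MulAction H V] {m n : ℕ}
    (hK : IsEquivariantObstructor H K m) (hL : ∃ b, IsEvaluationCycle L n b) :
    IsEquivariantObstructor H (joinComplex K L) (m + n + 2) := by
  obtain ⟨a, ha, A, hA, hsq, hsum⟩ := hK
  obtain ⟨b, hb⟩ := hL
  refine ⟨_, ha.join hb, A, hA, hsq, fun σ τ => ?_⟩
  simp_rw [pushforward_join, ← Finset.mul_sum, ← Finset.sum_mul, hsum, zero_mul, mul_zero]

end Join

/-! ### The cone on a join -/

section Cone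

variable {V : Type} [Fintype V] {K : AbstractSimplicialComplex V}

lemma isClosed_coneInfty (K : AbstractSimplicialComplex V) : IsClosed (ConeInfty K) := by
  have : ConeInfty K = (⋂ v, {w | 0 ≤ w v}) ∩
      ⋃ σ ∈ K.faces, ⋂ v, ⋂ (_ : v ∉ σ), {w : V → ℝ | w v = 0} := by
    ext w
    simp [ConeInfty]
  rw [this]
  refine (isClosed_iInter fun v => isClosed_le continuous_const (continuous_apply v)).inter
    (Set.Finite.isClosed_biUnion (Set.toFinite _) fun σ _ => isClosed_iInter fun v =>
      isClosed_iInter fun _ => isClosed_eq (continuous_apply v) continuous_const)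

/-- The coordinate `t` of `Cone_∞(K)`. -/
def coneHeight (w : ConeInfty K) : ℝ := ∑ v, w.1 v

lemma continuous_coneHeight : Continuous (coneHeight (K := K)) :=
  continuous_finsetSum _ fun v _ => (continuous_apply v).comp continuous_subtype_val

lemma isCompact_coneHeight_le (T : ℝ) : IsCompact {w : ConeInfty K | coneHeight w ≤ T} := by
  have hc : IsCompact (Subtype.val ⁻¹' Set.Icc 0 (fun _ => T) : Set (ConeInfty K)) :=
    (isClosed_coneInfty K).isClosedEmbedding_subtypeVal.isCompact_preimage isCompact_Icc
  refine hc.of_isClosed_subset (isClosed_le continuous_coneHeight continuous_const) ?_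
  intro w hw
  exact ⟨w.2.1, fun v =>
    (Finset.single_le_sum (fun u _ => w.2.1 u) (Finset.mem_univ v)).trans hw⟩

lemma coneHeight_eq_zero {w : ConeInfty K} (hw : w ∈ coneOver K ∅) : coneHeight w = 0 :=
  Finset.sum_eq_zero fun v _ => hw v (Finset.notMem_empty v)

/-- The cone point. -/
def coneApex [Nonempty V] (K : AbstractSimplicialComplex V) : ConeInfty K :=
  ⟨0, fun _ => le_rfl, _, K.singleton_mem (Classical.arbitrary V), fun _ _ => rfl⟩

lemma eq_coneApex [Nonempty V] {w : ConeInfty K} (hw : w ∈ coneOver K ∅) : w = coneApex K :=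
  Subtype.ext (funext fun v => hw v (Finset.notMem_empty v))

/-- Only one of the points has to be far out. If `y` is low, `f y` stays in a fixed ball, which `f
x` leaves by properness. Empty simplices are admitted; their cone is the apex. -/
lemma IsExpanding.exists_forall_le_dist {X : Type} [MetricSpace X] [ProperSpace X]
    {f : ConeInfty K → X} (hf : IsProperMap f) (he : IsExpanding f) {σ τ : Finset V}
    (hσ : IsSimplex K σ) (hτ : IsSimplex K τ) (hd : Disjoint σ τ) (R : ℝ) :
    ∃ T : ℝ, ∀ x ∈ coneOver K σ, ∀ y ∈ coneOver K τ, T ≤ coneHeight x →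
      R ≤ dist (f x) (f y) := by
  obtain ⟨T₀, hT₀⟩ : ∃ T : ℝ, ∀ x ∈ coneOver K σ, ∀ y ∈ coneOver K τ, T ≤ coneHeight x →
      T ≤ coneHeight y → R ≤ dist (f x) (f y) := by
    rcases σ.eq_empty_or_nonempty with rfl | hσ'
    -- The apex has height `0`, so the threshold `1` makes the claim vacuous.
    · refine ⟨1, fun x hx y _ h => ?_⟩
      rw [coneHeight_eq_zero hx] at h
      linarith
    rcases τ.eq_empty_or_nonempty with rfl | hτ'
    · refine ⟨1, fun x _ y hy _ h => ?_⟩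
      rw [coneHeight_eq_zero hy] at h
      linarith
    obtain ⟨T, hT⟩ := he σ (hσ hσ') τ (hτ hτ') hd R
    exact ⟨T, fun x hx y hy h h' => hT T le_rfl x ⟨hx, h⟩ y ⟨hy, h'⟩⟩
  rcases isEmpty_or_nonempty (ConeInfty K) with hemp | ⟨⟨p⟩⟩
  · exact ⟨0, fun x => hemp.elim x⟩
  obtain ⟨r, hr⟩ := ((isCompact_coneHeight_le T₀).image hf.continuous).isBounded.subset_closedBall
    (f p)
  have hc := hf.isCompact_preimage (isCompact_closedBall (f p) (r + R))
  obtain ⟨T₁, hT₁⟩ := (hc.image continuous_coneHeight).bddAbove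
  refine ⟨max T₀ (T₁ + 1), fun x hx y hy h => ?_⟩
  rcases le_total T₀ (coneHeight y) with hy' | hy'
  · exact hT₀ x hx y hy ((le_max_left _ _).trans h) hy'
  · have h1 : dist (f y) (f p) ≤ r := hr ⟨y, hy', rfl⟩
    have h2 : r + R < dist (f x) (f p) := by
      by_contra! hle
      have := hT₁ ⟨x, hle, rfl⟩
      have := (le_max_right _ _).trans h
      linarith
    have := dist_triangle (f x) (f y) (f p)
    linarith

end Cone

/-! ### The product of two cone maps. -/

section JoinCone

variable {V W : Type} [Fintype V] [Fintype W] [LinearOrder V] [LinearOrder W]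
  [Nonempty V] [Nonempty W]
  {K : AbstractSimplicialComplex V} {L : AbstractSimplicialComplex W}

/-- Over a simplex with empty left part the `K`-coordinate is the apex, which belongs to `Cone K`
only if `K` has a simplex; hence the nonemptiness of `V`. -/
lemma IsSimplex.exists_face {σ : Finset V} (h : IsSimplex K σ) :
    ∃ τ ∈ K.faces, σ ⊆ τ := by
  rcases σ.eq_empty_or_nonempty with rfl | hσ
  · exact ⟨_, K.singleton_mem (Classical.arbitrary V), Finset.empty_subset _⟩
  · exact ⟨σ, h hσ, subset_rfl⟩

/-- The infinite cone on a join is the product of the infinite cones. -/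
def coneJoinHomeomorph (K : AbstractSimplicialComplex V) (L : AbstractSimplicialComplex W) :
    ConeInfty (joinComplex K L) ≃ₜ ConeInfty K × ConeInfty L where
  toFun w :=
    (⟨fun v => w.1 (left v), fun v => w.2.1 _, by
      obtain ⟨σ, hσ, hw⟩ := w.2.2
      obtain ⟨τ, hτ, hs⟩ := hσ.2.1.exists_face
      exact ⟨τ, hτ, fun v hv => hw _ fun h => hv (hs (mem_leftPart.2 h))⟩⟩,
    ⟨fun v => w.1 (right v), fun v => w.2.1 _, by
      obtain ⟨σ, hσ, hw⟩ := w.2.2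
      obtain ⟨τ, hτ, hs⟩ := hσ.2.2.exists_face
      exact ⟨τ, hτ, fun v hv => hw _ fun h => hv (hs (mem_rightPart.2 h))⟩⟩)
  invFun p := ⟨fun x => match x with
      | left v => p.1.1 v
      | right w => p.2.1 w, by
    refine ⟨fun x => ?_, ?_⟩
    · cases x with
      | left v => exact p.1.2.1 v
      | right w => exact p.2.2.1 w
    obtain ⟨σ, hσ, h1⟩ := p.1.2.2
    obtain ⟨τ, hτ, h2⟩ := p.2.2.2
    refine ⟨(partsEquiv V W).symm (σ, τ), ⟨nonempty_of_leftPart ?_, ?_, ?_⟩, fun x hx => ?_⟩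
    · rw [leftPart_partsEquiv_symm]
      exact nonempty_of_mem_faces hσ
    · rw [leftPart_partsEquiv_symm]
      exact isSimplex_of_mem_faces hσ
    · rw [rightPart_partsEquiv_symm]
      exact isSimplex_of_mem_faces hτ
    · cases x with
      | left v => exact h1 v (by rwa [← mem_leftPart, leftPart_partsEquiv_symm] at hx)
      | right w => exact h2 w (by rwa [← mem_rightPart, rightPart_partsEquiv_symm] at hx)⟩
  left_inv w := by
    ext x
    cases x <;> rfl
  right_inv p := rfl
  continuous_toFun := by
    refine .prodMk (.subtype_mk ?_ _) (.subtype_mk ?_ _) <;>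
    exact continuous_pi fun v => (continuous_apply _).comp continuous_subtype_val
  continuous_invFun := by
    refine .subtype_mk (continuous_pi fun x => ?_) _
    cases x with
    | left v => exact (continuous_apply v).comp (continuous_subtype_val.comp continuous_fst)
    | right w => exact (continuous_apply w).comp (continuous_subtype_val.comp continuous_snd)

lemma coneJoin_fst_mem {σ : Finset (JoinVertex V W)} {w : ConeInfty (joinComplex K L)}
    (hw : w ∈ coneOver (joinComplex K L) σ) :
    (coneJoinHomeomorph K L w).1 ∈ coneOver K (leftPart σ) :=
  fun v hv => hw (left v) fun h => hv (mem_leftPart.2 h)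

lemma coneJoin_snd_mem {σ : Finset (JoinVertex V W)} {w : ConeInfty (joinComplex K L)}
    (hw : w ∈ coneOver (joinComplex K L) σ) :
    (coneJoinHomeomorph K L w).2 ∈ coneOver L (rightPart σ) :=
  fun v hv => hw (right v) fun h => hv (mem_rightPart.2 h)

lemma coneJoin_symm_mem {σ : Finset (JoinVertex V W)} {p : ConeInfty K × ConeInfty L}
    (h1 : p.1 ∈ coneOver K (leftPart σ)) (h2 : p.2 ∈ coneOver L (rightPart σ)) :
    (coneJoinHomeomorph K L).symm p ∈ coneOver (joinComplex K L) σ := by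
  intro x hx
  cases x with
  | left v => exact h1 v fun h => hx (mem_leftPart.1 h)
  | right w => exact h2 w fun h => hx (mem_rightPart.1 h)

lemma coneHeight_join (w : ConeInfty (joinComplex K L)) :
    coneHeight w =
      coneHeight (coneJoinHomeomorph K L w).1 + coneHeight (coneJoinHomeomorph K L w).2 :=
  JoinVertex.sum_univ _

variable {X Y : Type} [MetricSpace X] [MetricSpace Y]

/-- The map on the cone on a join induced by maps on the cones. -/
def coneJoinMap (f : ConeInfty K → X) (g : ConeInfty L → Y) (w : ConeInfty (joinComplex K L)) :
    X × Y :=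
  Prod.map f g (coneJoinHomeomorph K L w)

lemma isProperMap_coneJoinMap {f : ConeInfty K → X} {g : ConeInfty L → Y} (hf : IsProperMap f)
    (hg : IsProperMap g) : IsProperMap (coneJoinMap f g) :=
  (hf.prodMap hg).comp (coneJoinHomeomorph K L).isProperMap

lemma IsExpanding.coneJoinMap [ProperSpace X] [ProperSpace Y] {f : ConeInfty K → X}
    {g : ConeInfty L → Y} (hf : IsProperMap f) (hg : IsProperMap g) (hfe : IsExpanding f)
    (hge : IsExpanding g) : IsExpanding (coneJoinMap f g) := by
  intro σ hσ τ hτ hd R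
  obtain ⟨hd1, hd2⟩ := disjoint_parts hd
  obtain ⟨T₁, h1⟩ := hfe.exists_forall_le_dist hf hσ.2.1 hτ.2.1 hd1 R
  obtain ⟨T₂, h2⟩ := hge.exists_forall_le_dist hg hσ.2.2 hτ.2.2 hd2 R
  -- Heights add, so above `T₁ + T₂` one coordinate of `x` exceeds its own threshold, and the sup
  -- metric needs only that coordinate.
  refine ⟨T₁ + T₂, fun t ht x hx y hy => ?_⟩
  have hx' : T₁ + T₂ ≤ coneHeight x := ht.trans hx.2
  rw [coneHeight_join] at hx'
  rw [Prod.dist_eq, le_max_iff]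
  by_cases h : T₁ ≤ coneHeight (coneJoinHomeomorph K L x).1
  · exact Or.inl (h1 _ (coneJoin_fst_mem hx.1) _ (coneJoin_fst_mem hy.1) h)
  · exact Or.inr (h2 _ (coneJoin_snd_mem hx.1) _ (coneJoin_snd_mem hy.1) (by linarith))

/-- The action of a product of groups on a product of spaces. -/
abbrev prodMulAction (G₁ G₂ : Type*) (X Y : Type) [Group G₁] [Group G₂] [MulAction G₁ X]
    [MulAction G₂ Y] : MulAction (G₁ × G₂) (X × Y) where
  smul g x := (g.1 • x.1, g.2 • x.2)
  one_smul x := Prod.ext (one_smul G₁ x.1) (one_smul G₂ x.2)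
  mul_smul g h x := Prod.ext (mul_smul g.1 h.1 x.1) (mul_smul g.2 h.2 x.2)

attribute [local instance] prodMulAction

lemma IsPreserving.coneJoinMap {G₁ G₂ : Type*} [Group G₁] [Group G₂] [MulAction G₁ X]
    [MulAction G₂ Y] {H : Type} [Group H] [MulAction H V] {hK : IsInvariant H K}
    {f : ConeInfty K → X} {g : ConeInfty L → Y} (hf : IsPreserving (G := G₁) hK f)
    (hg : IsProperMap g) :
    IsPreserving (G := G₁ × G₂) (isInvariant_joinComplex (L := L) hK) (coneJoinMap f g) := by
  intro h
  obtain ⟨γ, R, hR, j, hj, hj0, hj1, hjR⟩ := hf h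
  -- The hypothesis on `f` says nothing about the empty simplex. When the left part is empty, the
  -- track of the apex, bounded by compactness, gives the constant `C`.
  have hcpt : IsCompact (Set.range fun s : unitInterval => j (s, coneApex K)) :=
    isCompact_range (hj.continuous.comp (.prodMk continuous_id continuous_const))
  obtain ⟨C, hC⟩ := hcpt.isBounded.subset_closedBall (f (coneAct hK h (coneApex K)))
  let e : unitInterval × ConeInfty (joinComplex K L) ≃ₜ
      (unitInterval × ConeInfty K) × ConeInfty L :=
    ((Homeomorph.refl _).prodCongr (coneJoinHomeomorph K L)).trans (Homeomorph.prodAssoc _ _ _).symm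
  refine ⟨(γ, 1), max R (C + 1), lt_max_of_lt_left hR, Prod.map j g ∘ e,
    (hj.prodMap hg).comp e.isProperMap, fun w => ?_, fun w => ?_, fun σ hσ s w hw => ?_⟩
  · exact Prod.ext (hj0 _) rfl
  · exact Prod.ext (hj1 _) (one_smul G₂ _).symm
  · rw [Metric.mem_thickening_iff]
    rcases (leftPart σ).eq_empty_or_nonempty with h0 | h0
    · refine ⟨_, ⟨w, hw, rfl⟩, ?_⟩
      have hw' : (coneJoinHomeomorph K L w).1 = coneApex K :=
        eq_coneApex (h0 ▸ coneJoin_fst_mem hw)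
      have hd : dist (j (s, (coneJoinHomeomorph K L w).1))
          (f (coneAct hK h (coneJoinHomeomorph K L w).1)) ≤ C := by
        rw [hw']
        exact hC ⟨s, rfl⟩
      have : dist ((Prod.map j g ∘ e) (s, w)) (EqObdim.coneJoinMap f g
          (coneAct (isInvariant_joinComplex hK) h w)) ≤ max C 0 := by
        rw [Prod.dist_eq]
        exact max_le_max hd (dist_self _).le
      refine this.trans_lt (max_lt ?_ ?_)
      · exact lt_max_of_lt_right (by linarith)
      · exact lt_max_of_lt_left hR
    · obtain ⟨-, ⟨u, hu, rfl⟩, hd⟩ := Metric.mem_thickening_iff.1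
        (hjR _ (hσ.2.1 h0) s _ (coneJoin_fst_mem hw))
      refine ⟨_, ⟨(coneJoinHomeomorph K L).symm (u, (coneJoinHomeomorph K L w).2),
        coneJoin_symm_mem hu (coneJoin_snd_mem hw), rfl⟩, ?_⟩
      have : dist ((Prod.map j g ∘ e) (s, w)) (EqObdim.coneJoinMap f g
          (coneAct (isInvariant_joinComplex hK) h ((coneJoinHomeomorph K L).symm
            (u, (coneJoinHomeomorph K L w).2)))) < R := by
        rw [Prod.dist_eq]
        exact max_lt hd ((dist_self _).trans_lt hR)
      exact this.trans_le (le_max_left _ _)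

end JoinCone

/-! ### Products of locally finite CW complexes -/

section CW

open Topology Set Metric RelCWComplex

variable {X Y : Type} [TopologicalSpace X] [TopologicalSpace Y]

/-- A compact set is contained in the union of finitely many closed cells. -/
lemma exists_finite_closedCell_cover [T2Space X] [CWComplex (univ : Set X)] {C : Set X}
    (hC : IsCompact C) :
    ∃ F : Set (Σ n, cell (univ : Set X) n), F.Finite ∧ C ⊆ ⋃ c ∈ F, closedCell c.1 c.2 := by
  -- Choose a point of `C` in each open cell that meets `C`. Every set of chosen points is closed,
  -- since a closed cell meets only finitely many open cells; so the chosen points form a compact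
  -- discrete set.
  let F : Set (Σ n, cell (univ : Set X) n) := {c | (openCell c.1 c.2 ∩ C).Nonempty}
  have hcover : C ⊆ ⋃ c ∈ F, closedCell c.1 c.2 := by
    intro x hx
    have hx' : x ∈ ⋃ (n : ℕ) (j : cell (univ : Set X) n), openCell n j := by
      rw [CWComplex.iUnion_openCell_eq_complex]; trivial
    simp only [mem_iUnion] at hx' ⊢
    obtain ⟨n, j, hj⟩ := hx'
    exact ⟨⟨n, j⟩, ⟨x, hj, hx⟩, openCell_subset_closedCell n j hj⟩
  refine ⟨F, ?_, hcover⟩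
  choose p hp using fun c : F => c.2
  have hpcell : ∀ (c : F) (d : Σ n, cell (univ : Set X) n), p c ∈ openCell d.1 d.2 → c.1 = d := by
    intro c d hd
    by_contra hne
    exact Set.disjoint_left.1 (disjoint_openCell_of_ne hne) (hp c).1 hd
  have hinj : Function.Injective p := fun c d hcd =>
    Subtype.ext (hpcell c d.1 (hcd ▸ (hp d).1))
  have hclosed : ∀ Q ⊆ range p, IsClosed Q := by
    intro Q hQ
    rw [CWComplex.closed univ Q (subset_univ _)]
    intro n j
    refine Set.Finite.isClosed ?_
    obtain ⟨I, hI⟩ := CWComplex.cellFrontier_subset_finite_openCell n j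
    let D : Set (Σ n, cell (univ : Set X) n) :=
      insert ⟨n, j⟩ ((Finset.range n).sigma I : Set (Σ n, cell (univ : Set X) n))
    have hD : D.Finite := (Finset.finite_toSet _).insert _
    refine ((hD.preimage (Subtype.val_injective (p := (· ∈ F))).injOn).image p).subset ?_
    rintro x ⟨hx, hxc⟩
    obtain ⟨c, rfl⟩ := hQ hx
    refine ⟨c, ?_, rfl⟩
    rw [← cellFrontier_union_openCell_eq_closedCell] at hxc
    rcases hxc with hxc | hxc
    · have := hI hxc
      simp only [mem_iUnion] at this
      obtain ⟨m, hm, i, hi, hxi⟩ := this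
      refine Or.inr ?_
      rw [hpcell c ⟨m, i⟩ hxi]
      simpa using ⟨hm, hi⟩
    · exact Or.inl (hpcell c ⟨n, j⟩ hxc)
  have hcpt : IsCompact (range p) :=
    hC.of_isClosed_subset (hclosed _ subset_rfl) (by rintro - ⟨c, rfl⟩; exact (hp c).2)
  have hdisc : DiscreteTopology (range p) := by
    rw [discreteTopology_iff_forall_isClosed]
    intro s
    have := (hclosed (Subtype.val '' s) (by rintro - ⟨x, -, rfl⟩; exact x.2)).preimage
      (continuous_subtype_val (p := (· ∈ range p)))
    rwa [preimage_image_eq _ Subtype.val_injective] at this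
  have hfin : (range p).Finite := hcpt.finite ⟨hdisc⟩
  rw [← Set.finite_coe_iff] at hfin ⊢
  exact Finite.of_injective (rangeFactorization p) (rangeFactorization_injective.2 hinj)

/-- Splitting the coordinates of a cube. -/
noncomputable def cubeSplit {k l n : ℕ} (h : k + l = n) :
    (Fin n → ℝ) ≃ᵢ (Fin k → ℝ) × (Fin l → ℝ) :=
  (Fin.appendIsometryOfEq h).symm

lemma cubeSplit_zero {k l n : ℕ} (h : k + l = n) : cubeSplit h 0 = 0 := by
  subst h
  rw [cubeSplit, IsometryEquiv.symm_apply_eq]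
  ext i
  refine Fin.addCases (fun i => ?_) (fun i => ?_) i <;>
  simp [Fin.appendIsometryOfEq, Fin.appendIsometry, Fin.appendEquiv]

lemma cubeSplit_symm_zero {k l n : ℕ} (h : k + l = n) : (cubeSplit h).symm 0 = 0 := by
  rw [IsometryEquiv.symm_apply_eq, cubeSplit_zero]

/-- In the sup norm, products of unit balls are unit balls, so products of characteristic maps need
no reparametrization. -/
lemma cubeSplit_preimage_ball {k l n : ℕ} (h : k + l = n) :
    cubeSplit h ⁻¹' (ball 0 1 ×ˢ ball 0 1) = ball 0 1 := by
  rw [ball_prod_same, IsometryEquiv.preimage_ball]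
  exact congrArg (ball · 1) (cubeSplit_symm_zero h)

lemma cubeSplit_preimage_closedBall {k l n : ℕ} (h : k + l = n) :
    cubeSplit h ⁻¹' (closedBall 0 1 ×ˢ closedBall 0 1) = closedBall 0 1 := by
  rw [closedBall_prod_same, IsometryEquiv.preimage_closedBall]
  exact congrArg (closedBall · 1) (cubeSplit_symm_zero h)

lemma cubeSplit_preimage_sphere {k l n : ℕ} (h : k + l = n) :
    cubeSplit h ⁻¹' (sphere 0 1 ×ˢ closedBall 0 1 ∪ closedBall 0 1 ×ˢ sphere 0 1) =
      sphere 0 1 := by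
  have := sphere_prod (0 : (Fin k → ℝ) × (Fin l → ℝ)) 1
  rw [Prod.fst_zero, Prod.snd_zero] at this
  rw [← this, IsometryEquiv.preimage_sphere, cubeSplit_symm_zero]

section Cells

variable [CWComplex (univ : Set X)] [CWComplex (univ : Set Y)]

/-- The `n`-cells of a product are the pairs of cells whose dimensions add up to `n`. -/
abbrev ProdCell (X Y : Type) [TopologicalSpace X] [TopologicalSpace Y] [CWComplex (univ : Set X)]
    [CWComplex (univ : Set Y)] (n : ℕ) : Type :=
  {c : (Σ k, cell (univ : Set X) k) × (Σ l, cell (univ : Set Y) l) // c.1.1 + c.2.1 = n}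

/-- The characteristic maps of a product. -/
noncomputable def prodCellMap {n : ℕ} (c : ProdCell X Y n) : PartialEquiv (Fin n → ℝ) (X × Y) :=
  (cubeSplit c.2).toEquiv.toPartialEquiv.trans
    ((map (C := (univ : Set X)) c.1.1.1 c.1.1.2).prod
      (map (C := (univ : Set Y)) c.1.2.1 c.1.2.2))

lemma prodCellMap_apply {n : ℕ} (c : ProdCell X Y n) (x : Fin n → ℝ) :
    prodCellMap c x = (map (C := (univ : Set X)) c.1.1.1 c.1.1.2 (cubeSplit c.2 x).1,
      map (C := (univ : Set Y)) c.1.2.1 c.1.2.2 (cubeSplit c.2 x).2) := rfl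

lemma prodCellMap_image {n : ℕ} (c : ProdCell X Y n) (s : Set (Fin c.1.1.1 → ℝ))
    (t : Set (Fin c.1.2.1 → ℝ)) :
    prodCellMap c '' (cubeSplit c.2 ⁻¹' (s ×ˢ t)) =
      (map (C := (univ : Set X)) c.1.1.1 c.1.1.2 '' s) ×ˢ
        (map (C := (univ : Set Y)) c.1.2.1 c.1.2.2 '' t) := by
  ext ⟨x, y⟩
  constructor
  · rintro ⟨z, hz, e⟩
    rw [prodCellMap_apply, Prod.mk.injEq] at e
    exact ⟨⟨_, hz.1, e.1⟩, ⟨_, hz.2, e.2⟩⟩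
  · rintro ⟨⟨u, hu, rfl⟩, ⟨v, hv, rfl⟩⟩
    refine ⟨(cubeSplit c.2).symm (u, v), ?_, ?_⟩
    · simpa using ⟨hu, hv⟩
    · simp [prodCellMap_apply]

lemma prodCellMap_image_ball {n : ℕ} (c : ProdCell X Y n) :
    prodCellMap c '' ball 0 1 = openCell c.1.1.1 c.1.1.2 ×ˢ openCell c.1.2.1 c.1.2.2 := by
  rw [← cubeSplit_preimage_ball c.2, prodCellMap_image]
  rfl

lemma prodCellMap_image_closedBall {n : ℕ} (c : ProdCell X Y n) :
    prodCellMap c '' closedBall 0 1 =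
      closedCell c.1.1.1 c.1.1.2 ×ˢ closedCell c.1.2.1 c.1.2.2 := by
  rw [← cubeSplit_preimage_closedBall c.2, prodCellMap_image]
  rfl

lemma prodCellMap_source {n : ℕ} (c : ProdCell X Y n) : (prodCellMap c).source = ball 0 1 := by
  have h1 := source_eq (C := (univ : Set X)) c.1.1.1 c.1.1.2
  have h2 := source_eq (C := (univ : Set Y)) c.1.2.1 c.1.2.2
  rw [← cubeSplit_preimage_ball c.2, ← h1, ← h2]
  simp [prodCellMap]

lemma continuousOn_prodCellMap {n : ℕ} (c : ProdCell X Y n) :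
    ContinuousOn (prodCellMap c) (closedBall 0 1) := by
  have h1 := continuousOn (C := (univ : Set X)) c.1.1.1 c.1.1.2
  have h2 := continuousOn (C := (univ : Set Y)) c.1.2.1 c.1.2.2
  refine (h1.prodMap h2).comp (cubeSplit c.2).continuous.continuousOn ?_
  rw [← cubeSplit_preimage_closedBall c.2]
  exact mapsTo_preimage _ _

lemma continuousOn_prodCellMap_symm {n : ℕ} (c : ProdCell X Y n) :
    ContinuousOn (prodCellMap c).symm (prodCellMap c).target := by
  have h1 := continuousOn_symm (C := (univ : Set X)) c.1.1.1 c.1.1.2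
  have h2 := continuousOn_symm (C := (univ : Set Y)) c.1.2.1 c.1.2.2
  refine (cubeSplit c.2).symm.continuous.comp_continuousOn ((h1.prodMap h2).mono ?_)
  intro x hx
  exact hx.1

lemma prodCell_pairwiseDisjoint :
    (univ : Set (Σ n, ProdCell X Y n)).PairwiseDisjoint
      (fun c => prodCellMap c.2 '' ball 0 1) := by
  rintro ⟨n, c, hc⟩ - ⟨m, d, hd⟩ - hne
  simp only [Function.onFun, prodCellMap_image_ball]
  rw [Set.disjoint_prod]
  by_contra! h
  have h1 : c.1 = d.1 := by
    by_contra hne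
    exact h.1 (disjoint_openCell_of_ne hne)
  have h2 : c.2 = d.2 := by
    by_contra hne
    exact h.2 (disjoint_openCell_of_ne hne)
  obtain rfl : c = d := Prod.ext h1 h2
  obtain rfl : n = m := hc.symm.trans hd
  exact hne rfl

lemma prodCell_mapsTo (n : ℕ) (c : ProdCell X Y n) :
    ∃ I : Π m, Finset (ProdCell X Y m), MapsTo (prodCellMap c) (sphere 0 1)
      (⋃ (m < n) (d ∈ I m), prodCellMap d '' closedBall 0 1) := by
  obtain ⟨I₁, h1⟩ := CWComplex.mapsTo (C := (univ : Set X)) c.1.1.1 c.1.1.2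
  obtain ⟨I₂, h2⟩ := CWComplex.mapsTo (C := (univ : Set Y)) c.1.2.1 c.1.2.2
  let S : Set ((Σ k, cell (univ : Set X) k) × (Σ l, cell (univ : Set Y) l)) :=
    ((Finset.range c.1.1.1).sigma I₁ : Set (Σ k, cell (univ : Set X) k)) ×ˢ {c.1.2} ∪
      {c.1.1} ×ˢ ((Finset.range c.1.2.1).sigma I₂ : Set (Σ l, cell (univ : Set Y) l))
  have hS : S.Finite :=
    ((Finset.finite_toSet _).prod (finite_singleton _)).union
      ((finite_singleton _).prod (Finset.finite_toSet _))
  have hfin : ∀ m, {d : ProdCell X Y m | d.1 ∈ S}.Finite := fun m =>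
    hS.preimage Subtype.val_injective.injOn
  refine ⟨fun m => (hfin m).toFinset, fun x hx => ?_⟩
  have hc := c.2
  rw [← cubeSplit_preimage_sphere c.2] at hx
  simp only [mem_iUnion, Finite.mem_toFinset]
  rcases hx with ⟨hx1, hx2⟩ | ⟨hx1, hx2⟩
  · have := h1 hx1
    simp only [mem_iUnion] at this
    obtain ⟨m, hm, i, hi, hxi⟩ := this
    refine ⟨m + c.1.2.1, by omega, ⟨(⟨m, i⟩, c.1.2), rfl⟩, Or.inl ?_, ?_⟩
    · exact ⟨by simpa using ⟨hm, hi⟩, rfl⟩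
    · rw [prodCellMap_image_closedBall]
      exact ⟨hxi, ⟨_, hx2, rfl⟩⟩
  · have := h2 hx2
    simp only [mem_iUnion] at this
    obtain ⟨m, hm, i, hi, hxi⟩ := this
    refine ⟨c.1.1.1 + m, by omega, ⟨(c.1.1, ⟨m, i⟩), rfl⟩, Or.inr ?_, ?_⟩
    · exact ⟨rfl, by simpa using ⟨hm, hi⟩⟩
    · rw [prodCellMap_image_closedBall]
      exact ⟨⟨_, hx1, rfl⟩, hxi⟩

/-- Closedness may be tested on compact sets. Each projects into finitely many closed cells of
either factor, hence lies in finitely many product cells. -/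
lemma prodCell_isClosed [T2Space X] [T2Space Y] [CompactlyCoherentSpace (X × Y)]
    (A : Set (X × Y))
    (hA : ∀ n (c : ProdCell X Y n), IsClosed (A ∩ prodCellMap c '' closedBall 0 1)) :
    IsClosed A := by
  rw [CompactlyCoherentSpace.isClosed_iff]
  intro C hC
  obtain ⟨F₁, hF₁, h1⟩ := exists_finite_closedCell_cover (hC.image continuous_fst)
  obtain ⟨F₂, hF₂, h2⟩ := exists_finite_closedCell_cover (hC.image continuous_snd)
  have hcl : IsClosed ((⋃ c ∈ F₁ ×ˢ F₂,
      A ∩ closedCell c.1.1 c.1.2 ×ˢ closedCell c.2.1 c.2.2) ∩ C) := by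
    refine ((hF₁.prod hF₂).isClosed_biUnion fun c _ => ?_).inter hC.isClosed
    have := hA _ (⟨c, rfl⟩ : ProdCell X Y (c.1.1 + c.2.1))
    rwa [prodCellMap_image_closedBall] at this
  convert hcl.preimage (continuous_subtype_val (p := (· ∈ C))) using 1
  ext ⟨x, hx⟩
  simp only [mem_preimage, mem_inter_iff, mem_iUnion, hx, and_true]
  refine ⟨fun hxA => ?_, fun ⟨c, hc, hxA, _⟩ => hxA⟩
  have h1x := h1 ⟨x, hx, rfl⟩
  have h2x := h2 ⟨x, hx, rfl⟩
  simp only [mem_iUnion] at h1x h2x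
  obtain ⟨c, hc, hcx⟩ := h1x
  obtain ⟨d, hd, hdx⟩ := h2x
  exact ⟨(c, d), ⟨hc, hd⟩, hxA, hcx, hdx⟩

lemma prodCell_iUnion :
    ⋃ (n : ℕ) (c : ProdCell X Y n), prodCellMap c '' closedBall 0 1 = univ := by
  refine eq_univ_of_forall fun ⟨x, y⟩ => ?_
  have hx : x ∈ ⋃ (n : ℕ) (j : cell (univ : Set X) n), closedCell n j := by
    rw [CWComplex.union]; trivial
  have hy : y ∈ ⋃ (n : ℕ) (j : cell (univ : Set Y) n), closedCell n j := by
    rw [CWComplex.union]; trivial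
  simp only [mem_iUnion] at hx hy ⊢
  obtain ⟨k, i, hi⟩ := hx
  obtain ⟨l, j, hj⟩ := hy
  refine ⟨k + l, ⟨(⟨k, i⟩, ⟨l, j⟩), rfl⟩, ?_⟩
  rw [prodCellMap_image_closedBall]
  exact ⟨hi, hj⟩

/-- The product CW structure. -/
noncomputable abbrev prodCWComplex [T2Space X] [T2Space Y] [CompactlyCoherentSpace (X × Y)] :
    CWComplex (univ : Set (X × Y)) where
  cell := ProdCell X Y
  map _ := prodCellMap
  source_eq _ := prodCellMap_source
  continuousOn _ := continuousOn_prodCellMap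
  continuousOn_symm _ := continuousOn_prodCellMap_symm
  pairwiseDisjoint' := prodCell_pairwiseDisjoint
  mapsTo' := prodCell_mapsTo
  closed' A _ := prodCell_isClosed A
  union' := prodCell_iUnion

end Cells

end CW

/-! ### Products of classifying spaces -/

section EG

open Topology

attribute [local instance] prodMulAction

/-- The product of an `EG₁` and an `EG₂` is an `E(G₁ × G₂)`. -/
theorem IsEG.prod {G₁ G₂ : Type*} {X Y : Type} [Group G₁] [Group G₂] [MetricSpace X]
    [MetricSpace Y] [MulAction G₁ X] [MulAction G₂ Y] (hX : IsEG G₁ X) (hY : IsEG G₂ Y) :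
    IsEG (G₁ × G₂) (X × Y) := by
  have := hX.contractible
  have := hY.contractible
  have := hX.properSpace
  have := hY.properSpace
  refine ⟨inferInstance, inferInstance, ⟨fun g => ?_⟩, ⟨fun {C D} hC hD => ?_⟩, ?_, ?_⟩
  · exact (hX.isometric.isometry_smul g.1).prodMap (hY.isometric.isometry_smul g.2)
  · refine ((hX.properlyDiscontinuous.finite_disjoint_inter_image (hC.image continuous_fst)
      (hD.image continuous_fst)).prod (hY.properlyDiscontinuous.finite_disjoint_inter_image
      (hC.image continuous_snd) (hD.image continuous_snd))).subset ?_
    rintro g ⟨-, ⟨x, hx, rfl⟩, hg⟩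
    exact ⟨⟨_, ⟨x.1, ⟨x, hx, rfl⟩, rfl⟩, ⟨_, hg, rfl⟩⟩, ⟨_, ⟨x.2, ⟨x, hx, rfl⟩, rfl⟩, ⟨_, hg, rfl⟩⟩⟩
  · obtain ⟨C, hC, h1⟩ := hX.cocompact
    obtain ⟨D, hD, h2⟩ := hY.cocompact
    refine ⟨C ×ˢ D, hC.prod hD, fun x => ?_⟩
    obtain ⟨g, hg⟩ := h1 x.1
    obtain ⟨h, hh⟩ := h2 x.2
    exact ⟨(g, h), hg, hh⟩
  · obtain ⟨cX, h1⟩ := hX.cellular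
    obtain ⟨cY, h2⟩ := hY.cellular
    refine ⟨prodCWComplex, fun g n c => ?_⟩
    obtain ⟨i, hi⟩ := h1 g.1 c.1.1.1 c.1.1.2
    obtain ⟨j, hj⟩ := h2 g.2 c.1.2.1 c.1.2.2
    refine ⟨(⟨(⟨c.1.1.1, i⟩, ⟨c.1.2.1, j⟩), c.2⟩ : ProdCell X Y n), ?_⟩
    refine Eq.trans ?_ (prodCellMap_image_ball _).symm
    refine (congrArg _ (prodCellMap_image_ball (c : ProdCell X Y n))).trans ?_
    rw [← hi, ← hj]
    exact Set.prodMap_image_prod _ _ _ _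

end EG

/-! ### Obstructor dimensions of products -/

/-- Without vertices the empty set is the only candidate simplex, so the pairing is zero. This
supplies the nonemptiness that `coneJoinHomeomorph` needs. -/
lemma IsEvaluationCycle.nonempty {V : Type} [Fintype V] [LinearOrder V]
    {K : AbstractSimplicialComplex V} {n : ℕ} {a : Finset V → Finset V → ℤ}
    (h : IsEvaluationCycle K n a) : Nonempty V := by
  by_contra hV
  rw [not_nonempty_iff] at hV
  obtain ⟨φ, -, hφ⟩ := h.vk_ne_zero
  refine hφ (Finset.sum_eq_zero fun σ _ => Finset.sum_eq_zero fun τ _ => ?_)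
  rw [Finset.eq_empty_of_isEmpty σ, h.chain.empty_left]
  simp

theorem HasEquivariantCone.prod {G₁ G₂ : Type*} [Group G₁] [Group G₂] {m n : ℕ}
    (h₁ : HasEquivariantCone G₁ m) (h₂ : HasEvaluationCone G₂ n) :
    HasEquivariantCone (G₁ × G₂) (m + n + 2) := by
  obtain ⟨X, _, _, V, _, _, K, H, _, _, _, hK, f, hX, hobs, hf, hfe, hfp⟩ := h₁
  obtain ⟨Y, _, _, W, _, _, L, g, hY, hcyc, hg, hge⟩ := h₂
  have : Nonempty V := by
    obtain ⟨a, ha, -⟩ := hobs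
    exact ha.nonempty
  have : Nonempty W := by
    obtain ⟨b, hb⟩ := hcyc
    exact hb.nonempty
  have := hX.properSpace
  have := hY.properSpace
  exact ⟨X × Y, inferInstance, prodMulAction G₁ G₂ X Y, JoinVertex V W, inferInstance, inferInstance,
    joinComplex K L, H, inferInstance, inferInstance, inferInstance, isInvariant_joinComplex hK,
    coneJoinMap f g, hX.prod hY, hobs.join hcyc, isProperMap_coneJoinMap hf hg,
    hfe.coneJoinMap hf hg hge, hfp.coneJoinMap hg⟩

lemma finite_of_natCast_le {S : Set (WithBot ℕ∞)} (hS : ∀ s ∈ S, ∃ k : ℕ, s = k) {m : ℕ}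
    (h : ∀ s ∈ S, s ≤ m) : S.Finite := by
  refine ((Set.finite_Iic m).image (fun k : ℕ => (k : WithBot ℕ∞))).subset fun s hs => ?_
  obtain ⟨k, rfl⟩ := hS s hs
  exact ⟨k, Nat.cast_le.1 (h _ hs), rfl⟩

/-- If `M` is finite and both sets are nonempty, nonnegativity bounds each set by `M`. The sets are
then finite, so both suprema are attained. -/
lemma sSup_add_sSup_le {S T : Set (WithBot ℕ∞)} (hS : ∀ s ∈ S, ∃ k : ℕ, s = k)
    (hT : ∀ t ∈ T, ∃ k : ℕ, t = k) {M : WithBot ℕ∞} (h : ∀ s ∈ S, ∀ t ∈ T, s + t ≤ M) :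
    sSup S + sSup T ≤ M := by
  rcases S.eq_empty_or_nonempty with rfl | ⟨s, hs⟩
  · simp
  rcases T.eq_empty_or_nonempty with rfl | ⟨t, ht⟩
  · simp
  have hS0 : ∀ s ∈ S, 0 ≤ s := fun s hs => by
    obtain ⟨k, rfl⟩ := hS s hs
    exact Nat.cast_nonneg k
  have hT0 : ∀ t ∈ T, 0 ≤ t := fun t ht => by
    obtain ⟨k, rfl⟩ := hT t ht
    exact Nat.cast_nonneg k
  have hM : 0 ≤ M := (add_nonneg (hS0 s hs) (hT0 t ht)).trans (h s hs t ht)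
  induction M with
  | bot => simp at hM
  | coe M =>
    induction M with
    | top => exact le_top
    | coe m =>
      refine h _ (Set.Nonempty.csSup_mem ⟨s, hs⟩ (finite_of_natCast_le (m := m) hS ?_)) _
        (Set.Nonempty.csSup_mem ⟨t, ht⟩ (finite_of_natCast_le (m := m) hT ?_))
      · exact fun s' hs' => (le_add_of_nonneg_right (hT0 t ht)).trans (h s' hs' t ht)
      · exact fun t' ht' => (le_add_of_nonneg_left (hS0 s hs)).trans (h s hs t' ht')

end EqObdim

theorem mainTheorem10 (G₁ G₂ : Type*) [Group G₁] [Group G₂] :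
    EqObdim.eqobdim G₁ + EqObdim.obdimZ G₂ ≤ EqObdim.eqobdim (G₁ × G₂) := by
  refine EqObdim.sSup_add_sSup_le ?_ ?_ ?_
  · rintro - ⟨n, -, rfl⟩
    exact ⟨_, rfl⟩
  · rintro - ⟨n, -, rfl⟩
    exact ⟨_, rfl⟩
  · rintro - ⟨m, hm, rfl⟩ - ⟨n, hn, rfl⟩
    -- The degrees match: `(m + 3) + (n + 2) = (m + n + 2) + 3`.
    refine le_sSup ⟨_, hm.prod hn, ?_⟩
    rw [← Nat.cast_add]
    congr 1
    omega
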